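/- An origami $O$ consists of finitely many copies of the Euclidean unit square together with permutations $\sigma_a,\sigma_b$ of the set of squares that generate a transitive group; the right edge of the square $i$ is glued by a translation to the left edge of $\sigma_a(i)$, and the upper edge of $i$ to the lower edge of $\sigma_b(i)$. Let $X^*$ be the resulting surface with all corners of squares removed. It carries the translation structure pulled back from the torus $\mathbb{R}^2/\mathbb{Z}^2$ along the map that sends each square to the unit square. The Veech group $\Gamma(O)\subseteq \mathrm{GL}_2(\mathbb{R})$ is the group of derivatives $A$ of the orientation preserving affine diffeomorphisms of $X^*$, i.e. those that are of the form $z\mapsto Az+z_0$ in local charts of the translation structure. A non-congruence group is a finite index subgroup of $\mathrm{SL}_2(\mathbb{Z})$ that contains no principal congruence group $\Gamma(N)=\ker(\mathrm{SL}_2(\mathbb{Z})\to \mathrm{SL}_2(\mathbb{Z}/N\mathbb{Z}))$, $N\ge 1$. Consider the following two sequences of origamis $(O_n)_{n\ge 1}$. 1. $n$ cyclic copies of $L(2,3)$: the squares are $1,\dots,4n$, with $$\sigma_a=(1\;3\;4\;5\;7\;8\;\ldots\;4n{-}3\;\,4n{-}1\;\,4n),\qquad \sigma_b=(1\;2)(5\;6)\cdots(4n{-}3\;\,4n{-}2).$$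 2. $n$ cyclic copies of $D$: the squares are $1,\dots,5n$, with $$\sigma_a=(1\;2\;3\;6\;7\;8\;\ldots\;5n{-}4\;\,5n{-}3\;\,5n{-}2),$$ $$\sigma_b=(1\;4\;5)(6\;9\;10)\cdots(5n{-}4\;\,5n{-}1\;\,5n)\,(2\;3)(7\;8)\cdots(5n{-}3\;\,5n{-}2).$$ For each of the two sequences the following holds. - $\Gamma(O_n)\subseteq\Gamma(O_1)$ for all $n\ge 1$, and $\Gamma(O_1)$ is a non-congruence group. - For all $n,m\ge 1$: if $n\mid m$, then $\Gamma(O_m)\subseteq\Gamma(O_n)$. - For all $n,m\ge 1$ with $n\neq m$: $\Gamma(O_n)\neq\Gamma(O_m)$. - For all $n\ge 1$ and $s\in\mathbb{Z}$: $\begin{pmatrix}1&s\\0&1\end{pmatrix}\in\Gamma(O_n)$ if and only if $3n$ divides $s$. -/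

import Mathlib

open Filter Topology
open scoped MatrixGroups

/-! ### Translation structures pulled back from the torus, and Veech groups -/

namespace TorusCover

/-- The projection from the plane to the torus `E = ℝ²/ℤ²`. -/
def planeToTorus (z : Fin 2 → ℝ) : UnitAddTorus (Fin 2) := fun k => (z k : UnitAddCircle)

/-- Let `p : X → E` be a map to the torus. A chart at `x` of the translation structure
pulled back from `E = ℝ²/ℤ²` is a continuous branch of `planeToTorus⁻¹ ∘ p` on a neighbourhood
of `x`. If `p` is a local homeomorphism, these are local homeomorphisms to the plane near `x`,
and two of them differ near `x` by a translation. -/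
def IsChartAt {X : Type*} [TopologicalSpace X] (p : X → UnitAddTorus (Fin 2)) (x : X)
    (φ : X → Fin 2 → ℝ) : Prop :=
  ∃ U ∈ 𝓝 x, ContinuousOn φ U ∧ ∀ y ∈ U, planeToTorus (φ y) = p y

/-- The homeomorphism `f` is affine with derivative `A`: around each point, in charts of the
translation structure, it has the form `z ↦ A z + z₀`. -/
def IsAffineWith {X : Type*} [TopologicalSpace X] (p : X → UnitAddTorus (Fin 2)) (f : X ≃ₜ X)
    (A : GL (Fin 2) ℝ) : Prop :=
  ∀ x : X, ∃ φ ψ : X → Fin 2 → ℝ, IsChartAt p x φ ∧ IsChartAt p (f x) ψ ∧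
    ∃ z₀ : Fin 2 → ℝ, ∀ᶠ y in 𝓝 x, ψ (f y) = A.1.mulVec (φ y) + z₀

section lemmas

variable {X : Type*} [TopologicalSpace X] {p : X → UnitAddTorus (Fin 2)}

theorem exists_isChartAt (hp : Continuous p) (x : X) : ∃ φ, IsChartAt p x φ := by
  have h : ∀ k : Fin 2, ∃ e : OpenPartialHomeomorph ℝ UnitAddCircle,
      p x k ∈ e.target ∧ ∀ t, e t = (t : UnitAddCircle) := by
    intro k
    obtain ⟨t, ht⟩ := QuotientAddGroup.mk_surjective (p x k)
    obtain ⟨e, he, hee⟩ := AddCircle.isLocalHomeomorph_coe (1 : ℝ) t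
    refine ⟨e, ?_, fun t => (congrFun hee t).symm⟩
    have := e.map_source he
    rw [← congrFun hee t] at this
    rwa [← ht]
  choose e he hee using h
  refine ⟨fun y k => (e k).symm (p y k), ⋂ k, {y | p y k ∈ (e k).target}, ?_, ?_, ?_⟩
  · rw [Filter.iInter_mem]
    intro k
    exact ((continuous_apply k).comp hp).continuousAt.preimage_mem_nhds
      ((e k).open_target.mem_nhds (he k))
  · refine continuousOn_pi.2 fun k => ?_
    refine (e k).continuousOn_symm.comp ((continuous_apply k).comp hp).continuousOn ?_
    intro y hy
    exact Set.mem_iInter.1 hy k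
  · intro y hy
    funext k
    have := (e k).right_inv (Set.mem_iInter.1 hy k)
    rwa [hee k] at this

theorem IsChartAt.eventually_eq_add {x : X} {φ ψ : X → Fin 2 → ℝ} (hφ : IsChartAt p x φ)
    (hψ : IsChartAt p x ψ) : ∃ c, ∀ᶠ y in 𝓝 x, ψ y = φ y + c := by
  obtain ⟨U, hU, cU, eU⟩ := hφ
  obtain ⟨V, hV, cV, eV⟩ := hψ
  refine ⟨ψ x - φ x, ?_⟩
  have hc : ContinuousAt (fun y => ψ y - φ y) x :=
    (cV.continuousAt hV).sub (cU.continuousAt hU)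
  have hint : ∀ y ∈ U ∩ V, ∀ k, ∃ n : ℤ, (n : ℝ) = ψ y k - φ y k := by
    intro y hy k
    have h1 := congrFun ((eV y hy.2).trans (eU y hy.1).symm) k
    have h2 : ((ψ y k - φ y k : ℝ) : UnitAddCircle) = 0 := by
      simpa [planeToTorus, sub_eq_zero] using h1
    obtain ⟨n, hn⟩ := (AddCircle.coe_eq_zero_iff (1 : ℝ)).1 h2
    exact ⟨n, by simpa using hn⟩
  filter_upwards [hU, hV, hc (Metric.ball_mem_nhds _ one_pos)] with y hyU hyV hy
  have hk : ∀ k, ψ y k - φ y k = ψ x k - φ x k := by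
    intro k
    obtain ⟨n, hn⟩ := hint y ⟨hyU, hyV⟩ k
    obtain ⟨m, hm⟩ := hint x ⟨mem_of_mem_nhds hU, mem_of_mem_nhds hV⟩ k
    have hd := (dist_pi_lt_iff one_pos).1 (Metric.mem_ball.1 hy) k
    simp only [Pi.sub_apply, Real.dist_eq] at hd
    rw [← hn, ← hm] at hd ⊢
    have hd' : |n - m| < 1 := by exact_mod_cast hd
    rw [sub_eq_zero.1 (Int.abs_lt_one_iff.1 hd')]
  funext k
  have := hk k
  simp only [Pi.add_apply, Pi.sub_apply]
  linarith

theorem isAffineWith_one (hp : Continuous p) : IsAffineWith p (Homeomorph.refl X) 1 := by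
  intro x
  obtain ⟨φ, hφ⟩ := exists_isChartAt hp x
  exact ⟨φ, φ, hφ, hφ, 0, by simp⟩

theorem IsAffineWith.trans {f g : X ≃ₜ X} {A B : GL (Fin 2) ℝ} (hf : IsAffineWith p f A)
    (hg : IsAffineWith p g B) : IsAffineWith p (g.trans f) (A * B) := by
  intro x
  obtain ⟨φ, ψ, hφ, hψ, b, hb⟩ := hg x
  obtain ⟨φ', ψ', hφ', hψ', a, ha⟩ := hf (g x)
  obtain ⟨c, hc⟩ := hψ.eventually_eq_add hφ'
  refine ⟨φ, ψ', hφ, hψ', A.1.mulVec (b + c) + a, ?_⟩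
  filter_upwards [hb, g.continuous.continuousAt.eventually ha,
    g.continuous.continuousAt.eventually hc] with y h1 h2 h3
  simp only [Homeomorph.trans_apply, h2, h3, h1, Units.val_mul, Matrix.mulVec_add,
    ← Matrix.mulVec_mulVec]
  abel

theorem IsAffineWith.symm {f : X ≃ₜ X} {A : GL (Fin 2) ℝ} (hf : IsAffineWith p f A) :
    IsAffineWith p f.symm A⁻¹ := by
  intro x
  obtain ⟨φ, ψ, hφ, hψ, a, ha⟩ := hf (f.symm x)
  rw [f.apply_symm_apply] at hψ
  refine ⟨ψ, φ, hψ, hφ, -(A⁻¹).1.mulVec a, ?_⟩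
  filter_upwards [f.symm.continuous.continuousAt.eventually ha] with y hy
  rw [f.apply_symm_apply] at hy
  have h1 : (A⁻¹).1 * A.1 = 1 := Units.inv_mul A
  rw [hy, Matrix.mulVec_add, Matrix.mulVec_mulVec, h1, Matrix.one_mulVec]
  abel

end lemmas

/-- The Veech group of the translation structure pulled back along `p`: the derivatives of the
orientation preserving affine homeomorphisms (such a map is automatically a diffeomorphism). -/
def veechGroup {X : Type*} [TopologicalSpace X] (p : X → UnitAddTorus (Fin 2))
    (hp : Continuous p) : Subgroup (GL (Fin 2) ℝ) where
  carrier := {A | 0 < A.1.det ∧ ∃ f : X ≃ₜ X, IsAffineWith p f A}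
  mul_mem' := by
    rintro A B ⟨hA, f, hf⟩ ⟨hB, g, hg⟩
    exact ⟨by simpa using mul_pos hA hB, g.trans f, hf.trans hg⟩
  one_mem' := ⟨by simp, Homeomorph.refl X, isAffineWith_one hp⟩
  inv_mem' := by
    rintro A ⟨hA, f, hf⟩
    refine ⟨?_, f.symm, hf.symm⟩
    have h1 : (A⁻¹).1.det * A.1.det = 1 := by
      rw [← Matrix.det_mul, Units.inv_mul, Matrix.det_one]
    exact (pos_iff_pos_of_mul_pos (by rw [h1]; exact one_pos)).2 hA

end TorusCover

/-! ### Origamis -/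

/-- An origami: finitely many unit squares; the right edge of the square `i` is glued to the left
edge of `right i`, and its upper edge to the lower edge of `up i`. The surface is connected, that
is, the two permutations generate a transitive group. -/
structure Origami where
  Square : Type
  finite : Finite Square
  nonempty : Nonempty Square
  right : Equiv.Perm Square
  up : Equiv.Perm Square
  connected : ∀ i j : Square, ∃ g ∈ Subgroup.closure {right, up}, g i = j

namespace Origami

/-- The closed unit square without its four corners. -/
def PuncturedSquare : Type :=
  {z : Fin 2 → ℝ // (∀ k, 0 ≤ z k ∧ z k ≤ 1) ∧ ¬ ∀ k, z k = 0 ∨ z k = 1}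

instance : TopologicalSpace PuncturedSquare := instTopologicalSpaceSubtype

/-- The elementary edge identifications; the squares form a disjoint union. -/
inductive Glue (O : Origami) : (Σ _ : O.Square, PuncturedSquare) →
    (Σ _ : O.Square, PuncturedSquare) → Prop
  | right (i : O.Square) (z w : PuncturedSquare) (hz : z.1 0 = 1) (hw : w.1 0 = 0)
      (h : z.1 1 = w.1 1) : Glue O ⟨i, z⟩ ⟨O.right i, w⟩
  | up (i : O.Square) (z w : PuncturedSquare) (hz : z.1 1 = 1) (hw : w.1 1 = 0)
      (h : z.1 0 = w.1 0) : Glue O ⟨i, z⟩ ⟨O.up i, w⟩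

/-- The punctured surface `X* = X - p⁻¹(∞)`, where `∞` is the image of the corners: the quotient
by the equivalence relation generated by the identifications, with the quotient topology. -/
def Surface (O : Origami) : Type := Quot O.Glue

instance (O : Origami) : TopologicalSpace O.Surface := instTopologicalSpaceQuot

/-- The covering `p` of the torus that maps each square to the unit square. -/
def proj (O : Origami) : O.Surface → UnitAddTorus (Fin 2) :=
  Quot.lift (fun q => TorusCover.planeToTorus q.2.1) (by
    have h10 : ((1 : ℝ) : UnitAddCircle) = ((0 : ℝ) : UnitAddCircle) := by
      simp
    rintro _ _ (⟨i, z, w, hz, hw, h⟩ | ⟨i, z, w, hz, hw, h⟩) <;> funext k <;> fin_cases k <;>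
      simp [TorusCover.planeToTorus, hz, hw, h, h10])

theorem continuous_proj (O : Origami) : Continuous O.proj := by
  refine continuous_quot_lift _ (continuous_sigma fun i => continuous_pi fun k => ?_)
  exact (AddCircle.continuous_mk' (1 : ℝ)).comp
    ((continuous_apply k).comp continuous_subtype_val)

/-- The Veech group `Γ(O) = Γ(X*, μ_I)`. -/
def veechGroup (O : Origami) : Subgroup (GL (Fin 2) ℝ) :=
  TorusCover.veechGroup O.proj O.continuous_proj

/-! ### The two sequences -/

theorem connected_of_reach {S : Type*} (r u : Equiv.Perm S) (b : S)
    (h : ∀ P : S → Prop, P b → (∀ s, P s → P (r s)) → (∀ s, P s → P (u s)) → ∀ s, P s)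
    (i j : S) : ∃ g ∈ Subgroup.closure {r, u}, g i = j := by
  have hr : r ∈ Subgroup.closure {r, u} := Subgroup.subset_closure (by simp)
  have hu : u ∈ Subgroup.closure {r, u} := Subgroup.subset_closure (by simp)
  have key : ∀ s, ∃ g ∈ Subgroup.closure {r, u}, g b = s := by
    refine h _ ⟨1, Subgroup.one_mem _, rfl⟩ ?_ ?_
    · rintro s ⟨g, hg, rfl⟩
      exact ⟨r * g, Subgroup.mul_mem _ hr hg, rfl⟩
    · rintro s ⟨g, hg, rfl⟩
      exact ⟨u * g, Subgroup.mul_mem _ hu hg, rfl⟩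
  obtain ⟨g, hg, rfl⟩ := key i
  obtain ⟨g', hg', rfl⟩ := key j
  exact ⟨g' * g⁻¹, Subgroup.mul_mem _ hg' (Subgroup.inv_mem _ hg), by simp⟩

theorem zmod_cyclic_induction {n : ℕ+} {P : ZMod n → Prop} (h0 : P 0)
    (h : ∀ k, P k → P (k + 1)) (k : ZMod n) : P k := by
  rw [← ZMod.natCast_zmod_val k]
  induction k.val with
  | zero => simpa using h0
  | succ m ih => simpa using h _ ih

/-- In each of `n` copies of `L(2,3)`, the squares `0, 2, 3` form the horizontal row and `1` lies
above `0`. The row of each copy continues cyclically in the row of the next copy: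
`0 → 2 → 3 → 0 of the next copy`. -/
def rightL (n : ℕ+) : Equiv.Perm (ZMod n × Fin 4) where
  toFun
    | (k, 0) => (k, 2)
    | (k, 1) => (k, 1)
    | (k, 2) => (k, 3)
    | (k, 3) => (k + 1, 0)
  invFun
    | (k, 0) => (k - 1, 3)
    | (k, 1) => (k, 1)
    | (k, 2) => (k, 0)
    | (k, 3) => (k, 2)
  left_inv := by rintro ⟨k, j⟩; fin_cases j <;> simp
  right_inv := by rintro ⟨k, j⟩; fin_cases j <;> simp

/-- In each copy of `L(2,3)` the vertical gluing is the transposition of `0` and `1`. -/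
def upL (n : ℕ+) : Equiv.Perm (ZMod n × Fin 4) :=
  Equiv.prodCongr (Equiv.refl _) (Equiv.swap 0 1)

/-- The origami made of `n` cyclically glued copies of `L(2,3)`. -/
def seqL (n : ℕ+) : Origami where
  Square := ZMod n × Fin 4
  finite := inferInstance
  nonempty := inferInstance
  right := rightL n
  up := upL n
  connected := connected_of_reach _ _ (0, 0) fun P h0 hr hu => by
    have h : ∀ k, P (k, 0) := zmod_cyclic_induction h0 fun k hk => hr _ (hr _ (hr _ hk))
    rintro ⟨k, j⟩
    fin_cases j
    · exact h k
    · exact hu _ (h k)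
    · exact hr _ (h k)
    · exact hr _ (hr _ (h k))

/-- In each of `n` copies of `D`, the squares `0, 1, 2` form the horizontal row and `3, 4` lie
above `0`. The row of each copy continues cyclically in the row of the next copy:
`0 → 1 → 2 → 0 of the next copy`. -/
def rightD (n : ℕ+) : Equiv.Perm (ZMod n × Fin 5) where
  toFun
    | (k, 0) => (k, 1)
    | (k, 1) => (k, 2)
    | (k, 2) => (k + 1, 0)
    | (k, 3) => (k, 3)
    | (k, 4) => (k, 4)
  invFun
    | (k, 0) => (k - 1, 2)
    | (k, 1) => (k, 0)
    | (k, 2) => (k, 1)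
    | (k, 3) => (k, 3)
    | (k, 4) => (k, 4)
  left_inv := by rintro ⟨k, j⟩; fin_cases j <;> simp
  right_inv := by rintro ⟨k, j⟩; fin_cases j <;> simp

/-- In each copy of `D` the vertical gluing has the cycles `0 → 3 → 4 → 0` and `1 → 2 → 1`. -/
def upD (n : ℕ+) : Equiv.Perm (ZMod n × Fin 5) :=
  Equiv.prodCongr (Equiv.refl _)
    { toFun := ![3, 2, 1, 4, 0]
      invFun := ![4, 2, 1, 0, 3]
      left_inv := by decide
      right_inv := by decide }

/-- The origami made of `n` cyclically glued copies of `D`. -/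
def seqD (n : ℕ+) : Origami where
  Square := ZMod n × Fin 5
  finite := inferInstance
  nonempty := inferInstance
  right := rightD n
  up := upD n
  connected := connected_of_reach _ _ (0, 0) fun P h0 hr hu => by
    have h : ∀ k, P (k, 0) := zmod_cyclic_induction h0 fun k hk => hr _ (hr _ (hr _ hk))
    rintro ⟨k, j⟩
    fin_cases j
    · exact h k
    · exact hr _ (h k)
    · exact hr _ (hr _ (h k))
    · exact hu _ (h k)
    · exact hu _ (hu _ (h k))

end Origami

/-- A subgroup of `GL₂(ℝ)` is a non-congruence group if it is a finite index subgroup of `SL₂(ℤ)`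
that contains no principal congruence group `Γ(N)`, `N ≥ 1`. -/
def IsNoncongruenceGroup (Γ : Subgroup (GL (Fin 2) ℝ)) : Prop :=
  ∃ G : Subgroup SL(2, ℤ), Γ = G.map (Matrix.SpecialLinearGroup.mapGL ℝ) ∧ G.FiniteIndex ∧
    ¬ CongruenceSubgroup.IsCongruenceSubgroup G

/-!
The ends of the surface of an origami are the corners of its squares, which lie over `0`, so an
affine homeomorphism descends to the torus and its derivative is integral. Hence the Veech group
consists of the matrices in `SL₂(ℤ)` whose action on the torus lifts to the surface. This action is
an automorphism `φ` of the free group on the horizontal and the vertical loop, and `A` lifts if and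
only if the origami is isomorphic to the one obtained by composing the gluing permutations with `φ`.

The translations of `m` cyclic copies form a cyclic group, generated by the shift of the copies. A
lift normalizes this group, so it descends to the quotient by a power of the shift, which consists
of `n` copies if `n` divides `m`. A horizontal shear preserves the vertical tower of squares
that are horizontally glued to themselves, and so it must rotate the horizontal cylinder below,
which has length `3n`, by a multiple of that length.
-/

namespace TorusCover

open Matrix.SpecialLinearGroup (mapGL)

section planeToTorus

theorem continuous_planeToTorus : Continuous planeToTorus :=
  continuous_pi fun k => (AddCircle.continuous_mk' (1 : ℝ)).comp (continuous_apply k)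

theorem planeToTorus_add (z w : Fin 2 → ℝ) :
    planeToTorus (z + w) = planeToTorus z + planeToTorus w := by
  funext k
  simp [planeToTorus]

theorem planeToTorus_eq_zero_iff {z : Fin 2 → ℝ} :
    planeToTorus z = 0 ↔ ∀ k, ∃ n : ℤ, z k = n := by
  refine funext_iff.trans (forall_congr' fun k =>
    (AddCircle.coe_eq_zero_iff (1 : ℝ)).trans (exists_congr fun n => ?_))
  rw [zsmul_one, eq_comm]

theorem planeToTorus_eq_zero_iff_of_mem {z : Fin 2 → ℝ} (hz : ∀ k, 0 ≤ z k ∧ z k ≤ 1) :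
    planeToTorus z = 0 ↔ ∀ k, z k = 0 ∨ z k = 1 := by
  refine planeToTorus_eq_zero_iff.trans (forall_congr' fun k => ⟨fun ⟨n, hn⟩ => ?_, ?_⟩)
  · have h0 : 0 ≤ n := by exact_mod_cast hn ▸ (hz k).1
    have h1 : n ≤ 1 := by exact_mod_cast hn ▸ (hz k).2
    obtain rfl | rfl : n = 0 ∨ n = 1 := by lia
    · exact Or.inl (by simpa using hn)
    · exact Or.inr (by simpa using hn)
  · rintro (h | h)
    · exact ⟨0, by simp [h]⟩
    · exact ⟨1, by simp [h]⟩

theorem injOn_planeToTorus :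
    Set.InjOn planeToTorus (Set.univ.pi fun _ => Set.Ico (0 : ℝ) 1) := by
  intro z hz w hw h
  funext k
  exact (AddCircle.coe_eq_coe_iff_of_mem_Ico (a := 0) (by simpa using hz k) (by simpa using hw k)).1
    (congrFun h k)

end planeToTorus

section torusEnd

/-- The endomorphism of the torus `ℝ²/ℤ²` induced by an integral matrix. -/
def torusEnd (A : SL(2, ℤ)) (e : UnitAddTorus (Fin 2)) : UnitAddTorus (Fin 2) :=
  fun k => ∑ l, A.1 k l • e l

theorem torusEnd_one (e : UnitAddTorus (Fin 2)) : torusEnd 1 e = e := by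
  funext k
  fin_cases k <;> simp [torusEnd]

theorem torusEnd_mul (A B : SL(2, ℤ)) (e : UnitAddTorus (Fin 2)) :
    torusEnd (A * B) e = torusEnd A (torusEnd B e) := by
  funext k
  simp only [torusEnd, Matrix.SpecialLinearGroup.coe_mul, Matrix.mul_apply, Fin.sum_univ_two,
    add_smul, mul_smul, smul_add]
  abel

theorem planeToTorus_mulVec (A : SL(2, ℤ)) (z : Fin 2 → ℝ) :
    planeToTorus ((mapGL ℝ A).1.mulVec z) = torusEnd A (planeToTorus z) := by
  funext k
  simp [planeToTorus, torusEnd, Matrix.mulVec, dotProduct, Fin.sum_univ_two, ← zsmul_eq_mul]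

end torusEnd

section affine

variable {X Y : Type*} [TopologicalSpace X] [TopologicalSpace Y] {p : X → UnitAddTorus (Fin 2)}

theorem IsChartAt.comp {γ : Y → X} {y : Y} {φ : X → Fin 2 → ℝ} (hφ : IsChartAt p (γ y) φ)
    (hγ : Continuous γ) : IsChartAt (p ∘ γ) y (φ ∘ γ) := by
  obtain ⟨U, hU, hφU, hφp⟩ := hφ
  exact ⟨γ ⁻¹' U, hγ.continuousAt hU, hφU.comp hγ.continuousOn fun _ => id, fun y hy => hφp _ hy⟩

theorem continuous_mulVec (A : GL (Fin 2) ℝ) : Continuous A.1.mulVec :=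
  Continuous.matrix_mulVec continuous_const continuous_id

theorem IsChartAt.mulVec {x : X} {φ : X → Fin 2 → ℝ} (hφ : IsChartAt p x φ) (A : SL(2, ℤ)) :
    IsChartAt (torusEnd A ∘ p) x fun y => (mapGL ℝ A).1.mulVec (φ y) := by
  obtain ⟨U, hU, hφU, hφp⟩ := hφ
  refine ⟨U, hU, (continuous_mulVec _).comp_continuousOn hφU, fun y hy => ?_⟩
  rw [planeToTorus_mulVec, hφp y hy, Function.comp_apply]

theorem isAffineWith_of_semiconj (hp : Continuous p) {f : X ≃ₜ X} {A : SL(2, ℤ)}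
    (hf : Function.Semiconj p f (torusEnd A)) : IsAffineWith p f (mapGL ℝ A) := by
  intro x
  obtain ⟨φ, hφ⟩ := exists_isChartAt hp x
  obtain ⟨ψ, hψ⟩ := exists_isChartAt hp (f x)
  refine ⟨φ, ψ, hφ, hψ, ?_⟩
  have hψf : IsChartAt (torusEnd A ∘ p) x (ψ ∘ f) := hf.comp_eq ▸ hψ.comp f.continuous
  exact (hφ.mulVec A).eventually_eq_add hψf

theorem IsAffineWith.exists_eq_planeToTorus_add [PreconnectedSpace Y] {f : X ≃ₜ X}
    {A : GL (Fin 2) ℝ} (hf : IsAffineWith p f A) {γ : Y → X} (hγ : Continuous γ)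
    {φ : Y → Fin 2 → ℝ} (hφ : Continuous φ) (hγφ : p ∘ γ = planeToTorus ∘ φ) :
    ∃ c, ∀ y, p (f (γ y)) = planeToTorus (A.1.mulVec (φ y)) + c := by
  have hloc : IsLocallyConstant fun y => p (f (γ y)) - planeToTorus (A.1.mulVec (φ y)) := by
    refine (IsLocallyConstant.iff_eventually_eq _).2 fun y₀ => ?_
    obtain ⟨χ, ψ, hχ, ⟨V, hV, -, hψp⟩, b, hb⟩ := hf (γ y₀)
    have hφ' : IsChartAt (p ∘ γ) y₀ φ :=
      ⟨Set.univ, univ_mem, hφ.continuousOn, fun y _ => (congrFun hγφ y).symm⟩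
    obtain ⟨c, hc⟩ := hφ'.eventually_eq_add (hχ.comp hγ)
    have hconst : ∀ᶠ y in 𝓝 y₀, p (f (γ y)) - planeToTorus (A.1.mulVec (φ y)) =
        planeToTorus (A.1.mulVec c + b) := by
      filter_upwards [hc, hγ.continuousAt.eventually hb, (f.continuous.comp hγ).continuousAt hV]
        with y hχφ hψχ hyV
      rw [← hψp (f (γ y)) hyV, hψχ, ← Function.comp_apply (f := χ), hχφ, Matrix.mulVec_add,
        add_assoc, planeToTorus_add (A.1.mulVec (φ y)), add_sub_cancel_left]
    filter_upwards [hconst] with y hy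
    rw [hy, hconst.self_of_nhds]
  cases isEmpty_or_nonempty Y with
  | inl _ => exact ⟨0, fun y => isEmptyElim y⟩
  | inr h =>
    obtain ⟨y₀⟩ := h
    refine ⟨p (f (γ y₀)) - planeToTorus (A.1.mulVec (φ y₀)), fun y => ?_⟩
    rw [← hloc.apply_eq_of_preconnectedSpace y y₀, add_sub_cancel]

end affine

end TorusCover

/-! ### The surface of an origami -/

namespace Origami

open TorusCover
open Matrix.SpecialLinearGroup (mapGL)

theorem forall_fin_two_iff (k : Fin 2) {P : Fin 2 → Prop} : (∀ l, P l) ↔ P k ∧ P (k + 1) := by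
  fin_cases k
  · exact Fin.forall_fin_two
  · exact Fin.forall_fin_two.trans and_comm

theorem add_one_ne_self (k : Fin 2) : k + 1 ≠ k := by
  decide +revert

namespace PuncturedSquare

theorem mem_iff (k : Fin 2) {z : Fin 2 → ℝ} :
    ((∀ l, 0 ≤ z l ∧ z l ≤ 1) ∧ ¬ ∀ l, z l = 0 ∨ z l = 1) ↔
      z k ∈ Set.Icc 0 1 ∧ z (k + 1) ∈ Set.Icc 0 1 ∧
        (z k = 0 ∨ z k = 1 → z (k + 1) ∈ Set.Ioo 0 1) := by
  rw [forall_fin_two_iff k, forall_fin_two_iff k, and_assoc, not_and]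
  refine and_congr_right fun _ => and_congr_right fun hl => imp_congr_right fun _ => ?_
  rw [not_or]
  exact ⟨fun h => ⟨hl.1.lt_of_ne' h.1, hl.2.lt_of_ne h.2⟩, fun h => ⟨h.1.ne', h.2.ne⟩⟩

theorem ext_of (k : Fin 2) {z w : PuncturedSquare} (hk : z.1 k = w.1 k)
    (hl : z.1 (k + 1) = w.1 (k + 1)) : z = w :=
  Subtype.ext (funext ((forall_fin_two_iff k).2 ⟨hk, hl⟩))

theorem eq_of_planeToTorus_eq {z w : PuncturedSquare} (hz : ∀ k, z.1 k < 1) (hw : ∀ k, w.1 k < 1)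
    (h : planeToTorus z.1 = planeToTorus w.1) : z = w :=
  Subtype.ext (injOn_planeToTorus (fun k _ => ⟨(z.2.1 k).1, hz k⟩)
    (fun k _ => ⟨(w.2.1 k).1, hw k⟩) h)

theorem exists_coords (k : Fin 2) {s t : ℝ} (hs : s ∈ Set.Icc 0 1) (ht : t ∈ Set.Ioo 0 1) :
    ∃ z : PuncturedSquare, z.1 k = s ∧ z.1 (k + 1) = t := by
  have hk : Function.update (fun _ => t) k s k = s := Function.update_self ..
  have hl : Function.update (fun _ => t) k s (k + 1) = t :=
    Function.update_of_ne (add_one_ne_self k) ..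
  refine ⟨⟨Function.update (fun _ => t) k s, (mem_iff k).2 ?_⟩, hk, hl⟩
  rw [hk, hl]
  exact ⟨hs, Set.Ioo_subset_Icc_self ht, fun _ => ht⟩

theorem exists_lt_one : ∃ z : PuncturedSquare, ∀ k, z.1 k < 1 := by
  obtain ⟨z, hz0, hz1⟩ := exists_coords 0 (s := 1 / 2) (t := 1 / 2) (by norm_num) (by norm_num)
  exact ⟨z, (forall_fin_two_iff 0).2 ⟨hz0.trans_lt one_half_lt_one, hz1.trans_lt one_half_lt_one⟩⟩

theorem continuous_coord (k : Fin 2) : Continuous fun z : PuncturedSquare => z.1 k :=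
  (continuous_apply k).comp continuous_subtype_val

theorem mem_of_mem_pi_Ioo {z : Fin 2 → ℝ} (hz : z ∈ Set.univ.pi fun _ => Set.Ioo (0 : ℝ) 1) :
    (∀ k, 0 ≤ z k ∧ z k ≤ 1) ∧ ¬ ∀ k, z k = 0 ∨ z k = 1 :=
  (mem_iff 0).2 ⟨Set.Ioo_subset_Icc_self (hz 0 trivial), Set.Ioo_subset_Icc_self (hz 1 trivial),
    fun _ => hz 1 trivial⟩

theorem closure_pi_Ioo : closure (Set.univ.pi fun _ : Fin 2 => Set.Ioo (0 : ℝ) 1) =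
    Set.univ.pi fun _ => Set.Icc 0 1 := by
  rw [closure_pi_set, closure_Ioo zero_ne_one]

instance : PreconnectedSpace PuncturedSquare := by
  have hconv : Convex ℝ (Set.univ.pi fun _ : Fin 2 => Set.Ioo (0 : ℝ) 1) :=
    convex_pi fun _ _ => convex_Ioo 0 1
  refine Subtype.preconnectedSpace (hconv.isPreconnected.subset_closure
    (fun z => mem_of_mem_pi_Ioo) ?_)
  rw [closure_pi_Ioo]
  exact fun z hz k _ => hz.1 k

end PuncturedSquare

section surface

variable (O : Origami)

/-- The point of the surface with coordinates `z` in the square `i`. -/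
def pt (i : O.Square) (z : PuncturedSquare) : O.Surface := Quot.mk _ ⟨i, z⟩

/-- The gluing permutation in the coordinate direction `k`: `right` for `k = 0`, `up` for
`k = 1`. The other direction is `k + 1`, computed in `Fin 2`. -/
def side : Fin 2 → Equiv.Perm O.Square := ![O.right, O.up]

variable {O}

theorem exists_pt (x : O.Surface) : ∃ i z, O.pt i z = x := by
  obtain ⟨⟨i, z⟩, rfl⟩ := Quot.exists_rep x
  exact ⟨i, z, rfl⟩

theorem pt_side (k : Fin 2) (i : O.Square) {z w : PuncturedSquare} (hz : z.1 k = 1)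
    (hw : w.1 k = 0) (h : z.1 (k + 1) = w.1 (k + 1)) : O.pt (O.side k i) w = O.pt i z := by
  fin_cases k
  · exact (Quot.sound (Glue.right i z w hz hw h)).symm
  · exact (Quot.sound (Glue.up i z w hz hw h)).symm

theorem exists_pt_lt_one (x : O.Surface) : ∃ i z, (∀ k, z.1 k < 1) ∧ O.pt i z = x := by
  obtain ⟨i, z, rfl⟩ := exists_pt x
  by_cases hz : ∀ k, z.1 k < 1
  · exact ⟨i, z, hz, rfl⟩
  · obtain ⟨k, hk⟩ := not_forall.1 hz
    have hzk : z.1 k = 1 := le_antisymm (z.2.1 k).2 (not_lt.1 hk)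
    have hl := ((PuncturedSquare.mem_iff k).1 z.2).2.2 (Or.inr hzk)
    obtain ⟨w, hwk, hwl⟩ := PuncturedSquare.exists_coords k ⟨le_rfl, zero_le_one⟩ hl
    exact ⟨O.side k i, w, (forall_fin_two_iff k).2 ⟨hwk.trans_lt one_pos, hwl.trans_lt hl.2⟩,
      pt_side k i hzk hwk hwl.symm⟩

theorem proj_pt (i : O.Square) (z : PuncturedSquare) : O.proj (O.pt i z) = planeToTorus z.1 :=
  rfl

theorem proj_ne_zero (x : O.Surface) : O.proj x ≠ 0 := by
  obtain ⟨i, z, rfl⟩ := exists_pt x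
  exact fun h => z.2.2 ((planeToTorus_eq_zero_iff_of_mem z.2.1).1 h)

theorem continuous_pt (i : O.Square) : Continuous (O.pt i) :=
  continuous_quot_mk.comp continuous_sigmaMk

theorem isOpen_surface_iff {U : Set O.Surface} : IsOpen U ↔ ∀ i, IsOpen (O.pt i ⁻¹' U) :=
  (isQuotientMap_quot_mk (r := O.Glue)).isOpen_preimage.symm.trans isOpen_sigma_iff

/-- The function on the surface that is given on the squares by a family of functions compatible
with the gluing. -/
def surfaceLift {β : Type*} (F : O.Square → PuncturedSquare → β)
    (hF : ∀ (k : Fin 2) (i : O.Square) (z w : PuncturedSquare), z.1 k = 1 → w.1 k = 0 →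
      z.1 (k + 1) = w.1 (k + 1) → F i z = F (O.side k i) w) : O.Surface → β :=
  Quot.lift (fun q => F q.1 q.2) (by
    rintro _ _ (⟨i, z, w, hz, hw, h⟩ | ⟨i, z, w, hz, hw, h⟩)
    · exact hF 0 i z w hz hw h
    · exact hF 1 i z w hz hw h)

theorem continuous_surfaceLift {β : Type*} [TopologicalSpace β]
    {F : O.Square → PuncturedSquare → β} {hF} (hcont : ∀ i, Continuous (F i)) :
    Continuous (surfaceLift F hF) :=
  continuous_quot_lift _ (continuous_sigma hcont)

end surface

section sheet

variable {O : Origami}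

/-- The sheet of the covering `proj` over the annulus around the torus in direction `k`, cut open
along the line with `k`-th coordinate `ξ`: it consists of the part of the square `i` to the left of
the cut and the part of the preceding square to the right of it. -/
def sheet (k : Fin 2) (ξ : Set.Ioo (0 : ℝ) 1) (i : O.Square) : Set O.Surface :=
  {x | surfaceLift (fun j z => z.1 (k + 1) ∈ Set.Ioo 0 1 ∧
    (z.1 k < ξ ∧ j = i ∨ ξ < z.1 k ∧ O.side k j = i)) (by
      intro k' j z w hz hw h
      obtain rfl | rfl : k' = k ∨ k' = k + 1 := by lia
      · simp [hz, hw, h, ξ.2.1, ξ.2.2, ξ.2.1.not_gt, ξ.2.2.not_gt]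
      · simp [hz, hw]) x}

theorem pt_mem_sheet {k : Fin 2} {ξ : Set.Ioo (0 : ℝ) 1} {i j : O.Square}
    {z : PuncturedSquare} : O.pt j z ∈ sheet k ξ i ↔ z.1 (k + 1) ∈ Set.Ioo 0 1 ∧
      (z.1 k < ξ ∧ j = i ∨ ξ < z.1 k ∧ O.side k j = i) :=
  Iff.rfl

theorem isOpen_sheet (k : Fin 2) (ξ : Set.Ioo (0 : ℝ) 1) (i : O.Square) :
    IsOpen (sheet k ξ i) := by
  refine isOpen_surface_iff.2 fun j => ?_
  have hk := PuncturedSquare.continuous_coord k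
  have hcut : IsOpen {z : PuncturedSquare | z.1 k < ξ ∧ j = i ∨ ξ < z.1 k ∧ O.side k j = i} :=
    IsOpen.union ((isOpen_lt hk continuous_const).and isOpen_const)
      ((isOpen_lt continuous_const hk).and isOpen_const)
  exact (isOpen_Ioo.preimage (PuncturedSquare.continuous_coord (k + 1))).inter hcut

theorem eq_of_mem_sheet {k : Fin 2} {ξ : Set.Ioo (0 : ℝ) 1} {i j : O.Square} {x : O.Surface}
    (hi : x ∈ sheet k ξ i) (hj : x ∈ sheet k ξ j) : i = j := by
  obtain ⟨l, z, rfl⟩ := exists_pt x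
  obtain ⟨-, ⟨hz, rfl⟩ | ⟨hz, rfl⟩⟩ := pt_mem_sheet.1 hi <;>
  obtain ⟨-, ⟨hz', rfl⟩ | ⟨hz', rfl⟩⟩ := pt_mem_sheet.1 hj
  · rfl
  · exact absurd hz hz'.not_gt
  · exact absurd hz hz'.not_gt
  · rfl

theorem injOn_proj_sheet (k : Fin 2) (ξ : Set.Ioo (0 : ℝ) 1) (i : O.Square) :
    Set.InjOn O.proj (sheet k ξ i) := by
  intro x hx y hy hxy
  obtain ⟨j, z, hz, rfl⟩ := exists_pt_lt_one x
  obtain ⟨l, w, hw, rfl⟩ := exists_pt_lt_one y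
  obtain rfl : z = w := PuncturedSquare.eq_of_planeToTorus_eq hz hw hxy
  obtain ⟨-, ⟨hz, rfl⟩ | ⟨hz, rfl⟩⟩ := pt_mem_sheet.1 hx <;>
  obtain ⟨-, ⟨hz', h⟩ | ⟨hz', h⟩⟩ := pt_mem_sheet.1 hy
  · rw [h]
  · exact absurd hz hz'.not_gt
  · exact absurd hz hz'.not_gt
  · rw [(O.side k).injective h]

theorem exists_pt_mem_sheet {z : PuncturedSquare} (hz : ∀ k, z.1 k < 1) :
    ∃ k ξ, ∀ i : O.Square, O.pt i z ∈ sheet k ξ i := by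
  obtain ⟨k, hk⟩ : ∃ k, 0 < z.1 (k + 1) := by
    by_contra! h
    exact z.2.2 ((forall_fin_two_iff (0 + 1)).2 ⟨Or.inl ((h 0).antisymm (z.2.1 _).1),
      Or.inl ((h (0 + 1)).antisymm (z.2.1 _).1)⟩)
  have hzk := (z.2.1 k).1
  exact ⟨k, ⟨(z.1 k + 1) / 2, by linarith, by linarith [hz k]⟩, fun i =>
    ⟨⟨hk, hz _⟩, Or.inl ⟨by linarith [hz k], rfl⟩⟩⟩

theorem isLocallyInjective_proj : IsLocallyInjective O.proj := by
  intro x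
  obtain ⟨i, z, hz, rfl⟩ := exists_pt_lt_one x
  obtain ⟨k, ξ, hmem⟩ := exists_pt_mem_sheet hz
  exact ⟨sheet k ξ i, isOpen_sheet k ξ i, hmem i, injOn_proj_sheet k ξ i⟩

theorem isSeparatedMap_proj : IsSeparatedMap O.proj := by
  intro x y hxy hne
  obtain ⟨i, z, hz, rfl⟩ := exists_pt_lt_one x
  obtain ⟨j, w, hw, rfl⟩ := exists_pt_lt_one y
  obtain rfl : z = w := PuncturedSquare.eq_of_planeToTorus_eq hz hw hxy
  obtain ⟨k, ξ, hmem⟩ := exists_pt_mem_sheet hz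
  exact ⟨sheet k ξ i, sheet k ξ j, isOpen_sheet k ξ i, isOpen_sheet k ξ j, hmem i, hmem j,
    Set.disjoint_left.2 fun p hi hj => hne (by rw [eq_of_mem_sheet hi hj])⟩

theorem pt_left_injective {z : PuncturedSquare} (hz : ∀ k, z.1 k < 1) :
    Function.Injective fun i => O.pt i z := by
  intro i j h
  obtain ⟨k, ξ, hmem⟩ := exists_pt_mem_sheet hz
  exact eq_of_mem_sheet (hmem i) ((congrArg (· ∈ sheet k ξ j) h).mpr (hmem j))

end sheet

variable {O O' O'' : Origami}

section lifts

/-- The automorphism of the torus given by `A` lifts to a homeomorphism between the surfaces of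
two origamis. -/
def Lifts (A : SL(2, ℤ)) (O O' : Origami) : Prop :=
  ∃ g : O.Surface ≃ₜ O'.Surface, ∀ x, O'.proj (g x) = torusEnd A (O.proj x)

theorem Lifts.trans {A B : SL(2, ℤ)} (h : Lifts A O O') (h' : Lifts B O' O'') :
    Lifts (B * A) O O'' := by
  obtain ⟨g, hg⟩ := h
  obtain ⟨g', hg'⟩ := h'
  exact ⟨g.trans g', fun x => by rw [Homeomorph.trans_apply, hg', hg, torusEnd_mul]⟩

theorem Lifts.symm {A : SL(2, ℤ)} (h : Lifts A O O') : Lifts A⁻¹ O' O := by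
  obtain ⟨g, hg⟩ := h
  refine ⟨g.symm, fun x => ?_⟩
  conv_rhs => rw [← g.apply_symm_apply x, hg, ← torusEnd_mul, inv_mul_cancel, torusEnd_one]

/-- Origamis are isomorphic if a bijection between their squares is compatible with the
gluings. -/
def Iso (O O' : Origami) : Prop :=
  ∃ h : O.Square ≃ O'.Square, ∀ k, Function.Semiconj h (O.side k) (O'.side k)

theorem Iso.symm (h : Iso O O') : Iso O' O := by
  obtain ⟨h, hh⟩ := h
  exact ⟨h.symm, fun k => (hh k).inverse_left h.left_inv h.right_inv⟩

theorem exists_forall_map_pt {g : O.Surface → O'.Surface} (hg : Continuous g)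
    (hproj : ∀ x, O'.proj (g x) = O.proj x) :
    ∃ h : O.Square → O'.Square, ∀ i z, g (O.pt i z) = O'.pt (h i) z := by
  obtain ⟨c, hc⟩ := PuncturedSquare.exists_lt_one
  have hcentre : ∀ i, ∃ j, g (O.pt i c) = O'.pt j c := fun i => by
    obtain ⟨j, w, hw, hjw⟩ := exists_pt_lt_one (g (O.pt i c))
    obtain rfl : w = c := PuncturedSquare.eq_of_planeToTorus_eq hw hc (by
      rw [← O'.proj_pt j, hjw, hproj, proj_pt])
    exact ⟨j, hjw.symm⟩
  choose h hh using hcentre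
  exact ⟨h, fun i => congrFun (isSeparatedMap_proj.eq_of_comp_eq isLocallyInjective_proj
    (hg.comp (continuous_pt i)) (continuous_pt (h i)) (funext fun z => hproj _) c (hh i))⟩

theorem Lifts.iso (h : Lifts 1 O O') : Iso O O' := by
  obtain ⟨g, hg⟩ := h
  simp only [torusEnd_one] at hg
  obtain ⟨h, hh⟩ := exists_forall_map_pt g.continuous hg
  obtain ⟨h', hh'⟩ := exists_forall_map_pt g.symm.continuous fun x => by
    rw [← hg, g.apply_symm_apply]
  obtain ⟨c, hc⟩ := PuncturedSquare.exists_lt_one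
  refine ⟨⟨h, h', fun i => ?_, fun i => ?_⟩, fun k i => ?_⟩
  · exact pt_left_injective hc (by simp only [← hh', ← hh, g.symm_apply_apply])
  · exact pt_left_injective hc (by simp only [← hh, ← hh', g.apply_symm_apply])
  · have hhalf : (1 / 2 : ℝ) ∈ Set.Ioo 0 1 := by norm_num
    obtain ⟨z, hzk, hzl⟩ := PuncturedSquare.exists_coords k ⟨zero_le_one, le_rfl⟩ hhalf
    obtain ⟨w, hwk, hwl⟩ := PuncturedSquare.exists_coords k ⟨le_rfl, zero_le_one⟩ hhalf
    have hw : ∀ l, w.1 l < 1 :=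
      (forall_fin_two_iff k).2 ⟨hwk.trans_lt one_pos, hwl.trans_lt hhalf.2⟩
    refine pt_left_injective hw ?_
    change O'.pt (h (O.side k i)) w = O'.pt (O'.side k (h i)) w
    rw [← hh, pt_side k i hzk hwk (hzl.trans hwl.symm), hh,
      pt_side k (h i) hzk hwk (hzl.trans hwl.symm)]

end lifts

section strip

variable {k : Fin 2}

/-- The infinite strip of unit width in direction `k`, without its integral points: the
universal covering of a row of squares. -/
abbrev Strip (k : Fin 2) : Type :=
  {z : Fin 2 → ℝ // z (k + 1) ∈ Set.Icc 0 1 ∧ (Int.fract (z k) = 0 → z (k + 1) ∈ Set.Ioo 0 1)}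

namespace Strip

theorem ext_of {z w : Strip k} (hk : z.1 k = w.1 k) (hl : z.1 (k + 1) = w.1 (k + 1)) : z = w :=
  Subtype.ext (funext ((forall_fin_two_iff k).2 ⟨hk, hl⟩))

/-- The affine shear `(x, y) ↦ (x + n + s y, y)` of the strip, where `x` is the coordinate in
direction `k`. -/
def shear (n s : ℤ) (z : Strip k) : Strip k :=
  ⟨Function.update z.1 k (z.1 k + n + s * z.1 (k + 1)), by
    rw [Function.update_self, Function.update_of_ne (add_one_ne_self k)]
    refine ⟨z.2.1, fun h => ?_⟩
    by_contra hl
    have hmem : z.1 (k + 1) = 0 ∨ z.1 (k + 1) = 1 := by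
      by_contra! hne
      exact hl ⟨z.2.1.1.lt_of_ne' hne.1, z.2.1.2.lt_of_ne hne.2⟩
    obtain ⟨m, hm⟩ : ∃ m : ℤ, s * z.1 (k + 1) = m := by
      rcases hmem with h0 | h0
      · exact ⟨0, by simp [h0]⟩
      · exact ⟨s, by simp [h0]⟩
    rw [hm, Int.fract_add_intCast, Int.fract_add_intCast] at h
    exact hl (z.2.2 h)⟩

theorem shear_apply_self (n s : ℤ) (z : Strip k) :
    (z.shear n s).1 k = z.1 k + n + s * z.1 (k + 1) :=
  Function.update_self ..

theorem shear_apply_add_one (n s : ℤ) (z : Strip k) : (z.shear n s).1 (k + 1) = z.1 (k + 1) :=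
  Function.update_of_ne (add_one_ne_self k) ..

theorem shear_shear (n s n' s' : ℤ) (z : Strip k) :
    (z.shear n s).shear n' s' = z.shear (n + n') (s + s') := by
  refine ext_of ?_ ?_
  · simp only [shear_apply_self, shear_apply_add_one]
    push_cast
    ring
  · simp only [shear_apply_add_one]

theorem shear_zero_zero (z : Strip k) : z.shear 0 0 = z := by
  refine ext_of ?_ (shear_apply_add_one ..)
  rw [shear_apply_self]
  simp

theorem continuous_shear (n s : ℤ) : Continuous (shear (k := k) n s) := by
  have hcoord (l : Fin 2) : Continuous fun z : Strip k => z.1 l :=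
    (continuous_apply l).comp continuous_subtype_val
  exact (continuous_subtype_val.update k (((hcoord k).add continuous_const).add
    (continuous_const.mul (hcoord (k + 1))))).subtype_mk _

/-- The point of the square with the coordinates of a point of the strip. -/
def toSquare (z : Strip k) (hz : z.1 k ∈ Set.Icc 0 1) : PuncturedSquare :=
  ⟨z.1, (PuncturedSquare.mem_iff k).2 ⟨hz, z.2.1, fun h => z.2.2 (by
    rcases h with h | h <;> simp [h])⟩⟩

end Strip

/-- The inclusion of the square into the strip. -/
def PuncturedSquare.toStrip (k : Fin 2) (z : PuncturedSquare) : Strip k :=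
  ⟨z.1, z.2.1 (k + 1), fun h => ((PuncturedSquare.mem_iff k).1 z.2).2.2 (by
    rcases (z.2.1 k).2.eq_or_lt with h1 | h1
    · exact Or.inr h1
    · exact Or.inl ((Int.fract_eq_self.2 ⟨(z.2.1 k).1, h1⟩).symm.trans h))⟩

theorem PuncturedSquare.continuous_toStrip : Continuous (PuncturedSquare.toStrip k) :=
  continuous_subtype_val.subtype_mk _

theorem Strip.shear_neg_floor_mem (z : Strip k) :
    (z.shear (-⌊z.1 k⌋) 0).1 k ∈ Set.Icc 0 1 := by
  rw [shear_apply_self]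
  constructor <;> push_cast <;> linarith [Int.floor_le (z.1 k), Int.lt_floor_add_one (z.1 k)]

theorem pt_zpow_side (k : Fin 2) (i : O.Square) {z w : PuncturedSquare} {m n : ℤ}
    (hw : w.1 k < 1) (hk : w.1 k + m = z.1 k + n) (hl : w.1 (k + 1) = z.1 (k + 1)) :
    O.pt ((O.side k ^ m) i) w = O.pt ((O.side k ^ n) i) z := by
  have hlower : n - 1 < m := by
    have : (n - 1 : ℝ) < m := by linarith [(z.2.1 k).1]
    exact_mod_cast this
  have hupper : m ≤ n + 1 := by
    have : (m : ℝ) ≤ n + 1 := by linarith [(z.2.1 k).2, (w.2.1 k).1]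
    exact_mod_cast this
  obtain rfl | rfl : m = n ∨ m = 1 + n := by lia
  · rw [PuncturedSquare.ext_of k (add_right_cancel hk) hl]
  · push_cast at hk
    rw [zpow_add, zpow_one, Equiv.Perm.mul_apply]
    have hwk : w.1 k = 0 := by linarith [(z.2.1 k).2, (w.2.1 k).1]
    exact pt_side k _ (by linarith) hwk hl.symm

/-- The covering of the row of squares in direction `k` that starts at the square `i`. -/
noncomputable def unroll (k : Fin 2) (i : O.Square) (z : Strip k) : O.Surface :=
  O.pt ((O.side k ^ ⌊z.1 k⌋) i) ((z.shear (-⌊z.1 k⌋) 0).toSquare z.shear_neg_floor_mem)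

theorem unroll_shear_toStrip (i : O.Square) (z : PuncturedSquare) (n : ℤ) :
    O.unroll k i ((z.toStrip k).shear n 0) = O.pt ((O.side k ^ n) i) z := by
  set x := (z.toStrip k).shear n 0
  have hxk : x.1 k = z.1 k + n :=
    (Strip.shear_apply_self ..).trans (by simp [PuncturedSquare.toStrip])
  have hfract : (x.shear (-⌊x.1 k⌋) 0).1 k = Int.fract (x.1 k) := by
    rw [Strip.shear_apply_self, Int.cast_neg, Int.cast_zero, zero_mul, add_zero, ← sub_eq_add_neg,
      Int.self_sub_floor]
  refine pt_zpow_side k i (hfract.trans_lt (Int.fract_lt_one _)) ?_ ?_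
  · exact (congrArg (· + _) hfract).trans ((Int.fract_add_floor _).trans hxk)
  · exact (Strip.shear_apply_add_one ..).trans (Strip.shear_apply_add_one ..)

end strip

/-! ### Shears -/

theorem semiconj_zpow {α β : Type*} {h : α → β} {f : Equiv.Perm α} {g : Equiv.Perm β}
    (hh : Function.Semiconj h f g) (n : ℤ) : Function.Semiconj h ⇑(f ^ n) ⇑(g ^ n) := by
  have hnat (m : ℕ) : Function.Semiconj h ⇑(f ^ m) ⇑(g ^ m) := by
    simpa only [Equiv.Perm.iterate_eq_pow] using hh.iterate_right m
  cases n with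
  | ofNat m => simpa using hnat m
  | negSucc m =>
    rw [zpow_negSucc, zpow_negSucc]
    exact (hnat (m + 1)).inverses_right (Equiv.apply_symm_apply _) (Equiv.symm_apply_apply _)

section shear

variable {k : Fin 2}

theorem exists_eq_shear_toStrip (z : Strip k) :
    ∃ (w : PuncturedSquare) (n : ℤ), z = (w.toStrip k).shear n 0 := by
  refine ⟨(z.shear (-⌊z.1 k⌋) 0).toSquare z.shear_neg_floor_mem, ⌊z.1 k⌋, ?_⟩
  change z = (z.shear (-⌊z.1 k⌋) 0).shear ⌊z.1 k⌋ 0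
  rw [Strip.shear_shear, neg_add_cancel, add_zero, Strip.shear_zero_zero]

theorem unroll_toStrip (i : O.Square) (z : PuncturedSquare) :
    O.unroll k i (z.toStrip k) = O.pt i z := by
  simpa [Strip.shear_zero_zero] using unroll_shear_toStrip (k := k) i z 0

theorem unroll_shear (i : O.Square) (z : Strip k) (n s : ℤ) :
    O.unroll k i (z.shear n s) = O.unroll k ((O.side k ^ n) i) (z.shear 0 s) := by
  obtain ⟨w, m, hw⟩ := exists_eq_shear_toStrip (z.shear 0 s)
  rw [hw, unroll_shear_toStrip, ← Equiv.Perm.mul_apply, ← zpow_add, ← unroll_shear_toStrip,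
    ← add_zero (0 : ℤ), ← Strip.shear_shear, ← hw, Strip.shear_shear, zero_add, add_zero]

theorem continuous_unroll (i : O.Square) : Continuous (O.unroll k i) := by
  have hk : Continuous fun z : Strip k => z.1 k :=
    (continuous_apply k).comp continuous_subtype_val
  have hcover : ⋃ n : ℤ, Set.Icc (n : ℝ) (n + 1) = Set.univ := iUnion_Icc_intCast ℝ
  have hfinite : LocallyFinite fun n : ℤ => Set.Icc (n : ℝ) (n + 1) := by
    refine fun x => ⟨Set.Icc (x - 1) (x + 1), Icc_mem_nhds (sub_one_lt x) (lt_add_one x),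
      (Set.finite_Icc (⌊x⌋ - 2) ⌈x + 1⌉).subset ?_⟩
    rintro n ⟨y, ⟨hny, hyn⟩, hxy, hyx⟩
    have hfloor : (⌊x⌋ : ℝ) ≤ n + 2 := by linarith [Int.floor_le x]
    have hceil : (n : ℝ) ≤ ⌈x + 1⌉ := by linarith [Int.le_ceil (x + 1)]
    norm_cast at hfloor hceil
    exact ⟨by lia, hceil⟩
  refine (hfinite.preimage_continuous hk).continuous ?_ (fun n => isClosed_Icc.preimage hk)
    fun n => ?_
  · rw [← Set.preimage_iUnion, hcover, Set.preimage_univ]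
  · have hmem (z : (fun z : Strip k => z.1 k) ⁻¹' Set.Icc (n : ℝ) (n + 1)) :
        (z.1.shear (-n) 0).1 k ∈ Set.Icc 0 1 := by
      rw [Strip.shear_apply_self]
      constructor <;> push_cast <;> linarith [z.2.1, z.2.2]
    have hcell (z : (fun z : Strip k => z.1 k) ⁻¹' Set.Icc (n : ℝ) (n + 1)) :
        O.unroll k i z.1 =
          O.pt ((O.side k ^ n) i) ((z.1.shear (-n) 0).toSquare (hmem z)) := by
      rw [← unroll_toStrip (k := k), ← Strip.shear_zero_zero (PuncturedSquare.toStrip k _),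
        ← unroll_shear]
      change _ = O.unroll k i ((z.1.shear (-n) 0).shear n 0)
      rw [Strip.shear_shear, neg_add_cancel, add_zero, Strip.shear_zero_zero]
    refine continuousOn_iff_continuous_domRestrict.2 ((continuous_congr hcell).2 ?_)
    exact (continuous_pt _).comp ((continuous_subtype_val.comp
      ((Strip.continuous_shear (-n) 0).comp continuous_subtype_val)).subtype_mk _)

/-- The elementary matrix that shears the plane in the direction `k`. -/
def shearMatrix (k : Fin 2) (s : ℤ) : SL(2, ℤ) :=
  Matrix.SpecialLinearGroup.transvection (add_one_ne_self k).symm s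

theorem torusEnd_shearMatrix (s : ℤ) (e : UnitAddTorus (Fin 2)) :
    torusEnd (shearMatrix k s) e k = e k + s • e (k + 1) ∧
      torusEnd (shearMatrix k s) e (k + 1) = e (k + 1) := by
  fin_cases k <;>
    simp [torusEnd, shearMatrix, Matrix.SpecialLinearGroup.transvection, Matrix.transvection,
      Fin.sum_univ_two, add_comm]

theorem planeToTorus_shear (z : Strip k) (n s : ℤ) :
    planeToTorus (z.shear n s).1 = torusEnd (shearMatrix k s) (planeToTorus z.1) := by
  obtain ⟨hk, hl⟩ := torusEnd_shearMatrix (k := k) s (planeToTorus z.1)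
  refine funext ((forall_fin_two_iff k).2 ⟨?_, ?_⟩)
  · rw [hk, planeToTorus, Strip.shear_apply_self]
    simp [planeToTorus, ← zsmul_eq_mul]
  · rw [hl, planeToTorus, Strip.shear_apply_add_one, planeToTorus]

theorem proj_unroll (i : O.Square) (z : Strip k) : O.proj (O.unroll k i z) = planeToTorus z.1 := by
  obtain ⟨w, n, rfl⟩ := exists_eq_shear_toStrip z
  rw [unroll_shear_toStrip, planeToTorus_shear, shearMatrix,
    Matrix.SpecialLinearGroup.transvection_coeff_zero, torusEnd_one]
  rfl

/-- The bijection `h` of the squares is compatible with the gluings after the squares have been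
sheared `s` times in the direction `k`: the shear moves the upper edge of a square by `s` squares
along its row. -/
def IsShear (k : Fin 2) (s : ℤ) (h : O.Square ≃ O'.Square) : Prop :=
  Function.Semiconj h (O.side k) (O'.side k) ∧
    ∀ i, h (O.side (k + 1) i) = O'.side (k + 1) ((O'.side k ^ s) (h i))

theorem IsShear.symm {s : ℤ} {h : O.Square ≃ O'.Square} (hh : IsShear k s h) :
    IsShear k (-s) h.symm := by
  have hk := hh.1.inverse_left h.left_inv h.right_inv
  refine ⟨hk, fun j => ?_⟩
  rw [Equiv.symm_apply_eq, hh.2, semiconj_zpow hh.1, h.apply_symm_apply, zpow_neg]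
  exact congrArg _ ((O'.side k ^ s).apply_symm_apply j).symm

/-- The map between the surfaces that shears each square `i`, starting at the square `h i`. -/
noncomputable def shearLift {s : ℤ} {h : O.Square ≃ O'.Square} (hh : IsShear k s h) :
    O.Surface → O'.Surface :=
  surfaceLift (fun i z => O'.unroll k (h i) ((z.toStrip k).shear 0 s)) (by
    intro k' i z w hz hw hzw
    obtain rfl | rfl : k' = k ∨ k' = k + 1 := by lia
    · have hshift : z.toStrip k' = (w.toStrip k').shear 1 0 :=
        Strip.ext_of (by rw [Strip.shear_apply_self]; simp [PuncturedSquare.toStrip, hz, hw])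
          (by rw [Strip.shear_apply_add_one]; exact hzw)
      rw [hshift, Strip.shear_shear, add_zero, zero_add, unroll_shear, zpow_one, hh.1]
    · have hupper : (z.toStrip k).shear 0 s = (z.toStrip k).shear s 0 :=
        Strip.ext_of (by simp [Strip.shear_apply_self, PuncturedSquare.toStrip, hz])
          (by simp [Strip.shear_apply_add_one])
      have hlower : (w.toStrip k).shear 0 s = w.toStrip k :=
        Strip.ext_of (by simp [Strip.shear_apply_self, PuncturedSquare.toStrip, hw])
          (by simp [Strip.shear_apply_add_one])
      rw [hupper, hlower, unroll_shear_toStrip, unroll_toStrip, hh.2, pt_side (k + 1) _ hz hw hzw])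

variable {s : ℤ} {h : O.Square ≃ O'.Square}

theorem shearLift_pt (hh : IsShear k s h) (i : O.Square) (z : PuncturedSquare) :
    shearLift hh (O.pt i z) = O'.unroll k (h i) ((z.toStrip k).shear 0 s) :=
  rfl

theorem shearLift_unroll (hh : IsShear k s h) (i : O.Square) (z : Strip k) :
    shearLift hh (O.unroll k i z) = O'.unroll k (h i) (z.shear 0 s) := by
  obtain ⟨w, n, rfl⟩ := exists_eq_shear_toStrip z
  rw [unroll_shear_toStrip, shearLift_pt, semiconj_zpow hh.1, ← unroll_shear, Strip.shear_shear,
    zero_add, add_zero]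

theorem shearLift_symm_shearLift {s' : ℤ} {h' : O'.Square ≃ O.Square} (hh : IsShear k s h)
    (hh' : IsShear k s' h') (hs : s + s' = 0) (hinv : Function.LeftInverse h' h) :
    Function.LeftInverse (shearLift hh') (shearLift hh) := by
  intro x
  obtain ⟨i, z, rfl⟩ := exists_pt x
  rw [shearLift_pt, shearLift_unroll, hinv, Strip.shear_shear, hs, add_zero, Strip.shear_zero_zero,
    unroll_toStrip]

theorem continuous_shearLift (hh : IsShear k s h) : Continuous (shearLift hh) :=
  continuous_surfaceLift fun i => (continuous_unroll (h i)).comp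
    ((Strip.continuous_shear 0 s).comp PuncturedSquare.continuous_toStrip)

theorem IsShear.lifts (hh : IsShear k s h) : Lifts (shearMatrix k s) O O' := by
  refine ⟨⟨⟨shearLift hh, shearLift hh.symm,
    shearLift_symm_shearLift _ _ (add_neg_cancel s) h.left_inv,
    shearLift_symm_shearLift _ _ (neg_add_cancel s) h.right_inv⟩,
    continuous_shearLift hh, continuous_shearLift hh.symm⟩, fun x => ?_⟩
  obtain ⟨i, z, rfl⟩ := exists_pt x
  exact (proj_unroll _ _).trans (planeToTorus_shear _ _ _)

theorem Iso.lifts (h : Iso O O') : Lifts 1 O O' := by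
  obtain ⟨h, hh⟩ := h
  have hshear : IsShear 0 0 h := ⟨hh 0, hh 1⟩
  simpa [shearMatrix] using hshear.lifts

end shear

theorem IsShear.apply_iterate_up {s : ℤ} {h : O.Square ≃ O'.Square}
    (hh : IsShear 0 s h) {x : O.Square} {r : ℕ}
    (hx : ∀ i < r, O.right (O.up^[i] x) = O.up^[i] x) :
    ∀ i ≤ r, h (O.up^[i] x) = O'.up^[i] (h x) := by
  intro i hi
  induction i with
  | zero => rfl
  | succ i ih =>
    have hfix : O'.right (h (O.up^[i] x)) = h (O.up^[i] x) := by
      rw [← hx i hi]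
      exact ((hh.1 _).symm.trans (congrArg h (congrArg O.right (hx i hi))))
    rw [Function.iterate_succ_apply', Function.iterate_succ_apply', ← ih (by omega)]
    refine (hh.2 _).trans (congrArg O'.up ?_)
    exact Equiv.Perm.zpow_apply_eq_self_of_apply_eq_self hfix s

/-! ### Affine maps and corners -/

section corners

theorem isCompact_preimage_proj {K : Set (UnitAddTorus (Fin 2))} (hK : IsClosed K)
    (h0 : (0 : UnitAddTorus (Fin 2)) ∉ K) : IsCompact (O.proj ⁻¹' K) := by
  have := O.finite
  have hbox : IsCompact (Set.univ.pi fun _ : Fin 2 => Set.Icc (0 : ℝ) 1) :=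
    isCompact_univ_pi fun _ => isCompact_Icc
  have hsquare := Topology.IsInducing.subtypeVal.isCompact_preimage'
    (hbox.inter_right (hK.preimage continuous_planeToTorus))
    fun z hz => ⟨(⟨z, fun k => hz.1 k trivial, fun h => h0 ?_⟩ : PuncturedSquare), rfl⟩
  · convert! isCompact_iUnion fun i : O.Square => hsquare.image (continuous_pt i)
    ext x
    obtain ⟨i, z, rfl⟩ := exists_pt x
    refine ⟨fun hx => Set.mem_iUnion.2 ⟨i, z, ⟨fun k _ => z.2.1 k, hx⟩, rfl⟩, fun hx => ?_⟩
    obtain ⟨j, w, ⟨-, hw⟩, hwz⟩ := Set.mem_iUnion.1 hx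
    exact hwz ▸ hw
  · rw [← (planeToTorus_eq_zero_iff_of_mem fun k => hz.1 k trivial).2 h]
    exact hz.2

theorem cocompact_eq_comap_proj : cocompact O.Surface = comap O.proj (𝓝 0) := by
  refine le_antisymm (tendsto_iff_comap.1 fun U hU => ?_) ?_
  · obtain ⟨V, hVU, hV, h0⟩ := mem_nhds_iff.1 hU
    refine mem_cocompact.2 ⟨O.proj ⁻¹' Vᶜ, isCompact_preimage_proj hV.isClosed_compl ?_, ?_⟩
    · exact fun h => h h0
    · exact fun x hx => hVU (not_not.1 hx)
  · refine hasBasis_cocompact.ge_iff.2 fun K hK => ?_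
    refine ⟨(O.proj '' K)ᶜ, (hK.image O.continuous_proj).isClosed.isOpen_compl.mem_nhds ?_, ?_⟩
    · rintro ⟨x, -, hx⟩
      exact proj_ne_zero x hx
    · exact fun x hx hxK => hx ⟨x, hxK, rfl⟩

/-- A homeomorphism preserves the ends of the surface, and these are the corners of the squares. -/
theorem planeToTorus_mulVec_add_eq_zero {f : O.Surface ≃ₜ O.Surface} {X : GL (Fin 2) ℝ}
    {i : O.Square} {c : UnitAddTorus (Fin 2)}
    (hc : ∀ z, O.proj (f (O.pt i z)) = planeToTorus (X.1.mulVec z.1) + c)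
    {q : Fin 2 → ℝ} (hq : ∀ k, q k = 0 ∨ q k = 1) : planeToTorus (X.1.mulVec q) + c = 0 := by
  have hq01 : ∀ k, q k ∈ Set.Icc 0 1 := fun k => by
    rcases hq k with h | h <;> simp [h]
  have hval : Tendsto Subtype.val (comap (Subtype.val : PuncturedSquare → _) (𝓝 q)) (𝓝 q) :=
    tendsto_comap
  have hne : (comap (Subtype.val : PuncturedSquare → _) (𝓝 q)).NeBot := by
    refine mem_closure_iff_comap_neBot.1 (closure_mono (fun z => ?_)
      (PuncturedSquare.closure_pi_Ioo.ge fun k _ => hq01 k))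
    exact PuncturedSquare.mem_of_mem_pi_Ioo
  have hend : Tendsto (fun z => O.pt i z) (comap Subtype.val (𝓝 q)) (cocompact _) := by
    rw [cocompact_eq_comap_proj, tendsto_comap_iff]
    have := (continuous_planeToTorus.tendsto q).comp hval
    rwa [(planeToTorus_eq_zero_iff_of_mem hq01).2 hq] at this
  have hzero : Tendsto (fun z => O.proj (f (O.pt i z))) (comap Subtype.val (𝓝 q)) (𝓝 0) := by
    refine Tendsto.comp ?_ (f.isClosedEmbedding.tendsto_cocompact.comp hend)
    exact tendsto_iff_comap.2 cocompact_eq_comap_proj.le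
  simp only [hc] at hzero
  exact tendsto_nhds_unique ((((continuous_planeToTorus.comp (continuous_mulVec X)).add
    continuous_const).tendsto q).comp hval) hzero

end corners

section veechGroup

theorem proj_apply_pt_of_isAffineWith {f : O.Surface ≃ₜ O.Surface} {X : GL (Fin 2) ℝ}
    (hf : IsAffineWith O.proj f X) (i : O.Square) (z : PuncturedSquare) :
    O.proj (f (O.pt i z)) = planeToTorus (X.1.mulVec z.1) := by
  obtain ⟨c, hc⟩ := hf.exists_eq_planeToTorus_add (continuous_pt i) continuous_subtype_val rfl
  have hcorner := planeToTorus_mulVec_add_eq_zero hc (q := 0) fun _ => Or.inl rfl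
  have hzero : planeToTorus 0 = 0 := planeToTorus_eq_zero_iff.2 fun _ => ⟨0, by simp⟩
  rw [Matrix.mulVec_zero, hzero, zero_add] at hcorner
  rw [hc, hcorner, add_zero]

theorem exists_eq_map_intCast {f : O.Surface ≃ₜ O.Surface} {X : GL (Fin 2) ℝ}
    (hf : IsAffineWith O.proj f X) : ∃ M : Matrix (Fin 2) (Fin 2) ℤ, X.1 = M.map Int.cast := by
  obtain ⟨i⟩ := O.nonempty
  have hentry : ∀ k l, ∃ n : ℤ, X.1 k l = n := fun k l => by
    have hcorner := planeToTorus_mulVec_add_eq_zero (c := 0) (q := Pi.single l 1)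
      (fun z => (proj_apply_pt_of_isAffineWith hf i z).trans (add_zero _).symm) fun m => by
        by_cases h : m = l <;> simp [h]
    rw [add_zero, Matrix.mulVec_single_one] at hcorner
    exact planeToTorus_eq_zero_iff.1 hcorner k
  choose M hM using hentry
  exact ⟨Matrix.of M, Matrix.ext hM⟩

theorem exists_lifts_of_mem_veechGroup {X : GL (Fin 2) ℝ} (h : X ∈ O.veechGroup) :
    ∃ A : SL(2, ℤ), mapGL ℝ A = X ∧ Lifts A O O := by
  obtain ⟨hdet, f, hf⟩ := h
  obtain ⟨M, hM⟩ := exists_eq_map_intCast hf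
  obtain ⟨N, hN⟩ := exists_eq_map_intCast hf.symm
  have hdetM : M.det = 1 := by
    have hdet_map (M : Matrix (Fin 2) (Fin 2) ℤ) : (M.map (Int.cast : ℤ → ℝ)).det = M.det :=
      (Int.cast_det M).symm
    have hinv : X.1.det * (X⁻¹).1.det = 1 := by
      rw [← Matrix.det_mul, Units.mul_inv, Matrix.det_one]
    rw [hM, hdet_map] at hdet hinv
    rw [hN, hdet_map] at hinv
    exact Int.eq_one_of_mul_eq_one_right (by exact_mod_cast hdet.le) (by exact_mod_cast hinv)
  obtain ⟨A, rfl⟩ : ∃ A : SL(2, ℤ), A.1 = M := ⟨⟨M, hdetM⟩, rfl⟩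
  have hA : mapGL ℝ A = X := Units.ext hM.symm
  refine ⟨A, hA, f, fun x => ?_⟩
  obtain ⟨i, z, rfl⟩ := exists_pt x
  rw [proj_apply_pt_of_isAffineWith hf, ← hA, planeToTorus_mulVec, proj_pt]

/-- The integral matrices in the Veech group of an origami. They are all of the Veech group, see
`veechGroup_eq_map`. -/
def integralVeechGroup (O : Origami) : Subgroup SL(2, ℤ) where
  carrier := {A | Lifts A O O}
  mul_mem' hA hB := hB.trans hA
  one_mem' := Iso.lifts ⟨Equiv.refl _, fun _ => .id_left⟩
  inv_mem' hA := hA.symm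

theorem mem_integralVeechGroup {A : SL(2, ℤ)} : A ∈ O.integralVeechGroup ↔ Lifts A O O :=
  Iff.rfl

theorem veechGroup_eq_map (O : Origami) :
    O.veechGroup = O.integralVeechGroup.map (mapGL ℝ) := by
  ext X
  constructor
  · intro hX
    obtain ⟨A, rfl, hA⟩ := exists_lifts_of_mem_veechGroup hX
    exact ⟨A, hA, rfl⟩
  · rintro ⟨A, ⟨f, hf⟩, rfl⟩
    refine ⟨?_, f, isAffineWith_of_semiconj O.continuous_proj hf⟩
    rw [← Matrix.GeneralLinearGroup.val_det_apply, Matrix.SpecialLinearGroup.det_mapGL]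
    exact one_pos

end veechGroup

variable {A B : SL(2, ℤ)} {φ ψ : MulAut (FreeGroup (Fin 2))}

theorem mapGL_mem_veechGroup : mapGL ℝ A ∈ O.veechGroup ↔ A ∈ O.integralVeechGroup := by
  rw [veechGroup_eq_map, Subgroup.mem_map_iff_mem Matrix.SpecialLinearGroup.mapGL_injective]

theorem veechGroup_le_veechGroup_iff :
    O.veechGroup ≤ O'.veechGroup ↔ O.integralVeechGroup ≤ O'.integralVeechGroup := by
  rw [veechGroup_eq_map, veechGroup_eq_map,
    Subgroup.map_le_map_iff_of_injective Matrix.SpecialLinearGroup.mapGL_injective]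

section monodromy

/-- The action of the free group on the horizontal and the vertical loop, which is the fundamental
group of the punctured torus, on the squares of an origami. -/
def monodromy (O : Origami) : FreeGroup (Fin 2) →* Equiv.Perm O.Square := FreeGroup.lift O.side

@[simp]
theorem monodromy_of (k : Fin 2) : O.monodromy (FreeGroup.of k) = O.side k :=
  FreeGroup.lift_apply_of

theorem exists_monodromy (i j : O.Square) : ∃ w, O.monodromy w i = j := by
  obtain ⟨g, hg, rfl⟩ := O.connected i j
  rw [← Matrix.range_cons_cons_empty _ _ ![], ← FreeGroup.range_lift_eq_closure] at hg
  obtain ⟨w, rfl⟩ := hg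
  exact ⟨w, rfl⟩

theorem semiconj_monodromy {h : O.Square → O'.Square}
    (hh : ∀ k, Function.Semiconj h (O.side k) (O'.side k)) (w : FreeGroup (Fin 2)) :
    Function.Semiconj h (O.monodromy w) (O'.monodromy w) := by
  induction w using FreeGroup.induction_on with
  | C1 => exact fun _ => by rw [map_one, map_one]; rfl
  | of k => rw [monodromy_of, monodromy_of]; exact hh k
  | inv_of k ih => rw [map_inv, map_inv, ← zpow_neg_one, ← zpow_neg_one]; exact semiconj_zpow ih _
  | mul v w hv hw => rw [map_mul, map_mul]; exact hv.comp_right hw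

theorem lift_monodromy_comp (φ : MulAut (FreeGroup (Fin 2))) :
    FreeGroup.lift ![O.monodromy (φ (FreeGroup.of 0)), O.monodromy (φ (FreeGroup.of 1))] =
      O.monodromy.comp φ.toMonoidHom :=
  FreeGroup.ext_hom _ _ (Fin.forall_fin_two.2 ⟨FreeGroup.lift_apply_of, FreeGroup.lift_apply_of⟩)

/-- The origami whose monodromy is that of `O` composed with an automorphism of the free group. -/
abbrev twist (O : Origami) (φ : MulAut (FreeGroup (Fin 2))) : Origami where
  Square := O.Square
  finite := O.finite
  nonempty := O.nonempty
  right := O.monodromy (φ (FreeGroup.of 0))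
  up := O.monodromy (φ (FreeGroup.of 1))
  connected i j := by
    obtain ⟨w, hw⟩ := exists_monodromy i j
    rw [← Matrix.range_cons_cons_empty _ _ ![], ← FreeGroup.range_lift_eq_closure,
      lift_monodromy_comp]
    exact ⟨O.monodromy w, ⟨φ⁻¹ w, congrArg O.monodromy (φ.apply_symm_apply w)⟩, hw⟩

theorem monodromy_twist (φ : MulAut (FreeGroup (Fin 2))) (w : FreeGroup (Fin 2)) :
    (O.twist φ).monodromy w = O.monodromy (φ w) :=
  DFunLike.congr_fun (lift_monodromy_comp φ) w

theorem side_twist (φ : MulAut (FreeGroup (Fin 2))) (k : Fin 2) :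
    (O.twist φ).side k = O.monodromy (φ (FreeGroup.of k)) := by
  rw [← monodromy_of, monodromy_twist]

end monodromy

section induces

/-- The automorphism of the torus given by `A` acts on the fundamental group of the punctured torus
by `φ`, as far as origamis can tell: `A` lifts to a map from every origami to its twist by `φ`. -/
def Induces (A : SL(2, ℤ)) (φ : MulAut (FreeGroup (Fin 2))) : Prop :=
  ∀ O : Origami, Lifts A O (O.twist φ)

theorem induces_one : Induces 1 1 := fun O =>
  Iso.lifts ⟨Equiv.refl _, fun k i => by rw [side_twist, MulAut.one_apply, monodromy_of]; rfl⟩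

theorem Induces.mul (hA : Induces A φ) (hB : Induces B ψ) : Induces (B * A) (φ * ψ) := by
  intro O
  have h : Iso ((O.twist φ).twist ψ) (O.twist (φ * ψ)) :=
    ⟨Equiv.refl _, fun k i => by rw [side_twist, side_twist, monodromy_twist]; rfl⟩
  simpa only [one_mul] using ((hA O).trans (hB _)).trans h.lifts

theorem Induces.inv (hA : Induces A φ) : Induces A⁻¹ φ⁻¹ := by
  intro O
  have h : Iso ((O.twist φ⁻¹).twist φ) O :=
    ⟨Equiv.refl _, fun k i => by rw [side_twist, monodromy_twist]; simp⟩
  simpa only [one_mul] using ((hA (O.twist φ⁻¹)).trans h.lifts).symm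

/-- The automorphism of the free group induced by a shear. It fixes the generator `k`. -/
def shearAut (k : Fin 2) (s : ℤ) : MulAut (FreeGroup (Fin 2)) :=
  MonoidHom.toMulEquiv
    (FreeGroup.lift fun l => if l = k then .of l else .of l * .of k ^ (-s))
    (FreeGroup.lift fun l => if l = k then .of l else .of l * .of k ^ s)
    (by ext l : 1; by_cases hl : l = k <;> simp [hl])
    (by ext l : 1; by_cases hl : l = k <;> simp [hl])

theorem shearAut_of_self (k : Fin 2) (s : ℤ) :
    shearAut k s (FreeGroup.of k) = FreeGroup.of k := by
  simp [shearAut]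

theorem shearAut_of_add_one (k : Fin 2) (s : ℤ) :
    shearAut k s (FreeGroup.of (k + 1)) = FreeGroup.of (k + 1) * FreeGroup.of k ^ (-s) := by
  simp [shearAut]

theorem side_twist_shearAut_self (O : Origami) (k : Fin 2) (s : ℤ) :
    (O.twist (shearAut k s)).side k = O.side k := by
  rw [side_twist, shearAut_of_self, monodromy_of]

theorem side_twist_shearAut_add_one (O : Origami) (k : Fin 2) (s : ℤ) :
    (O.twist (shearAut k s)).side (k + 1) = O.side (k + 1) * O.side k ^ (-s) := by
  rw [side_twist, shearAut_of_add_one, map_mul, map_zpow, monodromy_of, monodromy_of]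

theorem induces_shearMatrix (k : Fin 2) (s : ℤ) : Induces (shearMatrix k s) (shearAut k s) := by
  intro O
  refine IsShear.lifts (h := Equiv.refl O.Square) ⟨fun i => ?_, fun i => ?_⟩
  · rw [side_twist_shearAut_self]
    rfl
  · rw [side_twist_shearAut_self, side_twist_shearAut_add_one, zpow_neg]
    exact congrArg (O.side (k + 1)) ((O.side k ^ s).symm_apply_apply i).symm

theorem T_zpow_eq_shearMatrix (s : ℤ) : ModularGroup.T ^ s = shearMatrix 0 s := by
  ext k l
  rw [ModularGroup.coe_T_zpow]
  fin_cases k <;> fin_cases l <;>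
    simp [shearMatrix, Matrix.SpecialLinearGroup.transvection, Matrix.transvection]

theorem S_eq_shearMatrix_mul :
    ModularGroup.S = (shearMatrix 0 1)⁻¹ * shearMatrix 1 1 * (shearMatrix 0 1)⁻¹ := by
  decide

theorem exists_induces (A : SL(2, ℤ)) : ∃ φ, Induces A φ := by
  have hA : A ∈ Subgroup.closure {ModularGroup.S, ModularGroup.T} := by
    rw [SpecialLinearGroup.SL2Z_generators]
    exact Subgroup.mem_top A
  have hshear := fun k => induces_shearMatrix k 1
  induction hA using Subgroup.closure_induction with
  | mem x hx =>
    rcases hx with rfl | rfl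
    · exact ⟨_, S_eq_shearMatrix_mul ▸ ((hshear 0).inv.mul ((hshear 1).mul (hshear 0).inv))⟩
    · exact ⟨_, by simpa only [← T_zpow_eq_shearMatrix, zpow_one] using hshear 0⟩
  | one => exact ⟨_, induces_one⟩
  | mul x y _ _ hx hy =>
    obtain ⟨φ, hφ⟩ := hx
    obtain ⟨ψ, hψ⟩ := hy
    exact ⟨_, hψ.mul hφ⟩
  | inv x _ hx =>
    obtain ⟨φ, hφ⟩ := hx
    exact ⟨_, hφ.inv⟩

theorem Induces.mem_integralVeechGroup_iff (hA : Induces A φ) :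
    A ∈ O.integralVeechGroup ↔ Iso O (O.twist φ) := by
  rw [mem_integralVeechGroup]
  constructor
  · intro h
    exact Lifts.iso (by simpa only [mul_inv_cancel] using h.symm.trans (hA O))
  · intro h
    simpa only [one_mul] using (hA O).trans h.symm.lifts

theorem Induces.conj_mem (hA : Induces A φ) (hB : B ∈ (O.twist φ).integralVeechGroup) :
    A⁻¹ * B * A ∈ O.integralVeechGroup := by
  rw [mul_assoc]
  exact ((hA O).trans hB).trans (hA O).symm

theorem shearMatrix_mem_integralVeechGroup_iff {k : Fin 2} {s : ℤ} :
    shearMatrix k s ∈ O.integralVeechGroup ↔ ∃ h : Equiv.Perm O.Square, IsShear k s h := by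
  refine ⟨fun hs => ?_, fun ⟨h, hh⟩ => hh.lifts⟩
  obtain ⟨h, hh⟩ := ((induces_shearMatrix k s).mem_integralVeechGroup_iff.1 hs).symm
  have hk := hh k
  rw [side_twist_shearAut_self] at hk
  refine ⟨h, hk, fun i => ?_⟩
  have hl := hh (k + 1) ((O.side k ^ s) i)
  rw [side_twist_shearAut_add_one, zpow_neg, semiconj_zpow hk] at hl
  rw [← hl]
  exact congrArg (fun j => h (O.side (k + 1) j)) ((O.side k ^ s).symm_apply_apply i).symm

/-- Only finitely many origamis have the same squares as `O`. -/
instance finiteIndex_integralVeechGroup : O.integralVeechGroup.FiniteIndex := by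
  have := O.finite
  choose φ hφ using exists_induces
  have inv_mul_mem (A B) (h : (O.twist (φ A)).side = (O.twist (φ B)).side) :
      A⁻¹ * B ∈ O.integralVeechGroup := by
    have hiso : Iso (O.twist (φ B)) (O.twist (φ A)) :=
      ⟨Equiv.refl _, fun k i => by rw [h]; rfl⟩
    simpa only [mem_integralVeechGroup, one_mul] using
      ((hφ B O).trans hiso.lifts).trans (hφ A O).symm
  have : Finite (SL(2, ℤ) ⧸ O.integralVeechGroup) := by
    refine Finite.of_injective (β := Fin 2 → Equiv.Perm O.Square)
      (fun q => (O.twist (φ q.out)).side) fun q q' h => ?_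
    rw [← q.out_eq', ← q'.out_eq']
    exact QuotientGroup.eq.2 (inv_mul_mem _ _ h)
  exact Subgroup.finiteIndex_of_finite_quotient

end induces

section translations

/-- The translations of an origami: the permutations of its squares that are compatible with the
gluings. -/
def translations (O : Origami) : Subgroup (Equiv.Perm O.Square) :=
  Subgroup.centralizer (Set.range O.side)

variable {g g' : Equiv.Perm O.Square}

theorem mem_translations :
    g ∈ O.translations ↔ ∀ k, Function.Semiconj g (O.side k) (O.side k) := by
  simp only [translations, Subgroup.mem_centralizer_iff, Set.forall_mem_range, Equiv.ext_iff,
    Equiv.Perm.mul_apply, Function.Semiconj, eq_comm]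

theorem mem_translations_iff_monodromy :
    g ∈ O.translations ↔ ∀ w, Function.Semiconj g (O.monodromy w) (O.monodromy w) := by
  rw [mem_translations]
  exact ⟨semiconj_monodromy, fun h k => by simpa only [monodromy_of] using h (FreeGroup.of k)⟩

theorem translations_twist (φ : MulAut (FreeGroup (Fin 2))) :
    (O.twist φ).translations = O.translations := by
  ext g
  rw [mem_translations_iff_monodromy, mem_translations_iff_monodromy]
  refine Iff.trans (forall_congr' fun w => ?_) φ.surjective.forall.symm
  rw [monodromy_twist]

theorem eq_of_mem_translations (hg : g ∈ O.translations) (hg' : g' ∈ O.translations)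
    {i : O.Square} (h : g i = g' i) : g = g' := by
  rw [mem_translations_iff_monodromy] at hg hg'
  ext j
  obtain ⟨w, rfl⟩ := exists_monodromy i j
  rw [hg, hg', h]

theorem permCongr_mem_translations {h : O.Square ≃ O'.Square}
    (hh : ∀ k, Function.Semiconj h (O.side k) (O'.side k)) (hg : g ∈ O.translations) :
    h.permCongr g ∈ O'.translations := by
  rw [mem_translations] at hg ⊢
  intro k
  exact ((hh k).comp_left (hg k)).comp_left ((hh k).inverse_left h.left_inv h.right_inv)

/-- A lift to the covering origami permutes the fibres because it normalizes the group of all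
translations, whose subgroups are characteristic when it is cyclic. -/
theorem integralVeechGroup_le_of_cover {π : O'.Square → O.Square} (hπ : Function.Surjective π)
    (hside : ∀ k, Function.Semiconj π (O'.side k) (O.side k)) {σ : Equiv.Perm O'.Square}
    (hσ : O'.translations = Subgroup.zpowers σ) {n : ℤ}
    (hfib : ∀ i j, π i = π j ↔ (σ ^ n).SameCycle i j) :
    O'.integralVeechGroup ≤ O.integralVeechGroup := by
  intro A hA
  obtain ⟨φ, hφ⟩ := exists_induces A
  obtain ⟨h : Equiv.Perm O'.Square, hh⟩ := hφ.mem_integralVeechGroup_iff.1 hA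
  obtain ⟨a, ha⟩ : ∃ a : ℤ, σ ^ a = h * σ * h⁻¹ := by
    have hmem := permCongr_mem_translations (O' := O'.twist φ) hh (hσ ▸ Subgroup.mem_zpowers σ)
    rwa [translations_twist, hσ] at hmem
  have hdesc : (π ∘ h).FactorsThrough π := by
    intro i j hij
    have hconj : h * σ ^ n * h⁻¹ = (σ ^ n) ^ a := by
      rw [← conj_zpow, ← ha, ← zpow_mul, ← zpow_mul, mul_comm]
    exact (hfib _ _).2 (hconj ▸ ((hfib i j).1 hij).conj (g := h)).of_zpow
  have := O.nonempty
  have := O.finite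
  obtain ⟨g, hg⟩ := (Function.factorsThrough_iff _).1 hdesc
  have hsurj : Function.Surjective g := .of_comp (hg ▸ hπ.comp h.surjective)
  refine hφ.mem_integralVeechGroup_iff.2
    ⟨.ofBijective g (Finite.injective_iff_bijective.1 (Finite.injective_iff_surjective.2 hsurj)),
      fun k => hπ.forall.2 fun i => ?_⟩
  have hgπ := fun j => (congrFun hg j).symm
  have hπ' : Function.Semiconj π ((O'.twist φ).side k) ((O.twist φ).side k) := by
    rw [side_twist, side_twist]
    exact semiconj_monodromy hside _
  change g (O.side k (π i)) = (O.twist φ).side k (g (π i))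
  simp only [Function.comp_apply] at hgπ
  rw [← hside, hgπ, hgπ, hh, hπ']

end translations

/-! ### A non-congruence criterion -/

theorem exists_idempotent_mod {N : ℕ} (hN : N ≠ 0) :
    ∃ e : ℤ, 12 ∣ e - 4 ∧ (N : ℤ) ∣ e * (1 - e) := by
  obtain ⟨b, M, hM, rfl⟩ := Nat.exists_eq_pow_mul_and_not_dvd hN 3 (by norm_num)
  have hcop : IsCoprime ((3 : ℤ) ^ (b + 1)) (4 * M) := by
    refine IsCoprime.pow_left (IsCoprime.mul_right (by norm_num) ?_)
    exact_mod_cast Nat.isCoprime_iff_coprime.2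
      ((Nat.Prime.coprime_iff_not_dvd Nat.prime_three).2 hM)
  obtain ⟨x, y, hxy⟩ := hcop
  refine ⟨y * (4 * M), ?_, ?_⟩
  · have h4 : (4 : ℤ) ∣ y * (4 * M) := ⟨y * M, by ring⟩
    have h3 : (3 : ℤ) ∣ 1 - y * (4 * M) := ⟨x * 3 ^ b, by rw [← hxy]; ring⟩
    omega
  · refine ⟨y * 4 * (x * 3), ?_⟩
    rw [← eq_sub_of_add_eq hxy]
    push_cast
    ring

open scoped commutatorElement in
theorem commutator_shearMatrix_mem_Gamma {N : ℕ} {e f : ℤ} (h : (N : ℤ) ∣ e * f) :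
    ⁅shearMatrix 0 e, shearMatrix 1 f⁆ ∈ CongruenceSubgroup.Gamma N := by
  have hef : (e : ZMod N) * f = 0 := by
    exact_mod_cast (ZMod.intCast_zmod_eq_zero_iff_dvd (e * f) N).2 h
  have hcomm : (⁅shearMatrix 0 e, shearMatrix 1 f⁆).1 =
      !![1 + e * f + (e * f) ^ 2, -(e * (e * f)); f * (e * f), 1 - e * f] := by
    rw [commutatorElement_def, shearMatrix, shearMatrix,
      Matrix.SpecialLinearGroup.transvection_inv, Matrix.SpecialLinearGroup.transvection_inv]
    ext k l
    fin_cases k <;> fin_cases l <;>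
      simp [Matrix.SpecialLinearGroup.transvection_coe, Matrix.mul_apply, Fin.sum_univ_two] <;>
      ring
  rw [CongruenceSubgroup.Gamma_mem, hcomm]
  simp [hef]

theorem conj_shearMatrix_mem {O : Origami} {e f : ℤ} (h : (O.right * O.up ^ (-f)) ^ e = 1) :
    (shearMatrix 1 f)⁻¹ * shearMatrix 0 e * shearMatrix 1 f ∈ O.integralVeechGroup := by
  refine (induces_shearMatrix 1 f).conj_mem (shearMatrix_mem_integralVeechGroup_iff.2
    ⟨1, .id_left, fun i => congrArg ((O.twist (shearAut 1 f)).side 1) ?_⟩)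
  have hside : (O.twist (shearAut 1 f)).side 0 = O.right * O.up ^ (-f) :=
    side_twist_shearAut_add_one O 1 f
  rw [hside, h]
  rfl

/-- If `Γ(N)` were contained in the Veech group, take `e ≡ 4` modulo 12 with `e (1 - e) ≡ 0` modulo
`N`. The commutator of `T⁻ᵉ` and the vertical shear by `1 - e` is in `Γ(N)`, and the conjugate of
`Tᵉ` by this shear is in the Veech group because the horizontal cylinders of the sheared
origami have lengths dividing 4. Hence `Tᵉ` is in the Veech group, although `e ≡ 1` modulo 3. -/
theorem isNoncongruenceGroup_veechGroup {O : Origami}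
    (hT : ∀ s : ℤ, shearMatrix 0 s ∈ O.integralVeechGroup → 3 ∣ s)
    (hup : O.up ^ (12 : ℤ) = 1) (hright : (O.right * O.up ^ (-3 : ℤ)) ^ (4 : ℤ) = 1) :
    IsNoncongruenceGroup O.veechGroup := by
  refine ⟨O.integralVeechGroup, veechGroup_eq_map O, inferInstance, ?_⟩
  rintro ⟨N, hN, hle⟩
  obtain ⟨e, ⟨t, ht⟩, hNe⟩ := exists_idempotent_mod hN
  have hpow : (O.right * O.up ^ (-(e - 1))) ^ e = 1 := by
    have hexp : -(e - 1) = -3 + 12 * -t := by linarith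
    have he : e = 4 * (1 + 3 * t) := by linarith
    rw [hexp, zpow_add, zpow_mul _ 12, hup, one_zpow, mul_one, he, zpow_mul, hright, one_zpow]
  have hinv (k s) : shearMatrix k (-s) = (shearMatrix k s)⁻¹ :=
    (Matrix.SpecialLinearGroup.transvection_inv _ _).symm
  have hcomm : shearMatrix 0 (-e) *
      ((shearMatrix 1 (e - 1))⁻¹ * shearMatrix 0 e * shearMatrix 1 (e - 1)) ∈
        O.integralVeechGroup := by
    have hmem := hle (commutator_shearMatrix_mem_Gamma (e := -e) (f := -(e - 1))
      (by rw [neg_sub, neg_mul]; exact hNe.neg_right))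
    simpa only [commutatorElement_def, hinv, inv_inv, mul_assoc] using hmem
  have := hT _ ((Subgroup.mul_mem_cancel_right _ (conj_shearMatrix_mem hpow)).1 hcomm)
  omega

end Origami

/-! ### Cyclic copies -/

namespace Origami

/-- The sequence `O` consists of `n` cyclically glued copies of one origami with squares `J`, for
every `n`. The upper neighbour of a square is in the same copy, and the right neighbour of the
square `j` is `carry j` copies further on. -/
structure CyclicCopies (O : ℕ+ → Origami) (J : Type*) where
  square (n : ℕ+) : ZMod n × J ≃ (O n).Square
  right : Equiv.Perm J
  up : Equiv.Perm J
  carry : J → ℤ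
  right_square (n : ℕ+) (a : ZMod n) (j : J) :
    (O n).right (square n (a, j)) = square n (a + carry j, right j)
  up_square (n : ℕ+) (a : ZMod n) (j : J) : (O n).up (square n (a, j)) = square n (a, up j)

namespace CyclicCopies

variable {O : ℕ+ → Origami} {J : Type*} (c : CyclicCopies O J)

theorem zpow_square {n : ℕ+} {ρ : Equiv.Perm (O n).Square} {j : J} {d : ZMod n}
    (h : ∀ a, ρ (c.square n (a, j)) = c.square n (a + d, j)) (z : ℤ) (a : ZMod n) :
    (ρ ^ z) (c.square n (a, j)) = c.square n (a + z * d, j) := by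
  have hsemi : Function.Semiconj (fun a => c.square n (a, j)) (Equiv.addRight d) ρ :=
    fun a => (h a).symm
  rw [← zsmul_eq_mul]
  simpa only [Equiv.zsmul_addRight, Equiv.coe_addRight] using (semiconj_zpow hsemi z a).symm

theorem zpow_right_square (n : ℕ+) (z : ℤ) (a : ZMod n) (j : J) :
    ((c.square n).symm (((O n).right ^ z) (c.square n (a, j)))).2 = (c.right ^ z) j := by
  have hsemi : Function.Semiconj (fun x => ((c.square n).symm x).2) (O n).right c.right :=
    (c.square n).surjective.forall.2 fun ⟨a, j⟩ => by
      simp only [right_square, Equiv.symm_apply_apply]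
  simpa using semiconj_zpow hsemi z (c.square n (a, j))

theorem iterate_up_square (n : ℕ+) (i : ℕ) (a : ZMod n) (j : J) :
    (O n).up^[i] (c.square n (a, j)) = c.square n (a, c.up^[i] j) :=
  ((show Function.Semiconj (fun j => c.square n (a, j)) c.up (O n).up from
    fun j => (c.up_square n a j).symm).iterate_right i j).symm

section shift

/-- The translation of each copy to the next one. -/
def shift (n : ℕ+) : Equiv.Perm (O n).Square :=
  (c.square n).permCongr (Equiv.prodCongr (Equiv.addRight 1) (Equiv.refl J))

theorem shift_square (n : ℕ+) (a : ZMod n) (j : J) :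
    c.shift n (c.square n (a, j)) = c.square n (a + 1, j) := by
  simp [shift]

theorem shift_zpow_square (n : ℕ+) (z : ℤ) (a : ZMod n) (j : J) :
    (c.shift n ^ z) (c.square n (a, j)) = c.square n (a + z, j) := by
  rw [c.zpow_square fun a => c.shift_square n a j, mul_one]

theorem shift_mem_translations (n : ℕ+) : c.shift n ∈ (O n).translations := by
  refine mem_translations.2 (Fin.forall_fin_two.2
    ⟨(c.square n).surjective.forall.2 ?_, (c.square n).surjective.forall.2 ?_⟩) <;>
    rintro ⟨a, j⟩
  · change c.shift n ((O n).right _) = (O n).right _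
    rw [right_square, shift_square, shift_square, right_square, add_right_comm]
  · change c.shift n ((O n).up _) = (O n).up _
    rw [up_square, shift_square, shift_square, up_square]

end shift

section cover

variable {n m : ℕ+} (h : (n : ℕ) ∣ m)

/-- The covering of `n` copies by `m` copies if `n` divides `m`. -/
def cover (x : (O m).Square) : (O n).Square :=
  c.square n (Prod.map (ZMod.castHom h (ZMod n)) id ((c.square m).symm x))

theorem cover_square (a : ZMod m) (j : J) :
    c.cover h (c.square m (a, j)) = c.square n (ZMod.castHom h (ZMod n) a, j) := by
  rw [cover, Equiv.symm_apply_apply]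
  rfl

theorem surjective_cover : Function.Surjective (c.cover h) :=
  (c.square n).surjective.comp
    (((ZMod.castHom_surjective h).prodMap Function.surjective_id).comp (c.square m).symm.surjective)

theorem semiconj_cover (k : Fin 2) :
    Function.Semiconj (c.cover h) ((O m).side k) ((O n).side k) := by
  refine (Fin.forall_fin_two (p := fun k => Function.Semiconj _ ((O m).side k) ((O n).side k))).2
    ⟨(c.square m).surjective.forall.2 ?_, (c.square m).surjective.forall.2 ?_⟩ k <;>
    rintro ⟨a, j⟩
  · change c.cover h ((O m).right _) = (O n).right _
    rw [right_square, cover_square, cover_square, right_square, map_add, map_intCast]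
  · change c.cover h ((O m).up _) = (O n).up _
    rw [up_square, cover_square, cover_square, up_square]

theorem cover_eq_cover_iff (x y : (O m).Square) :
    c.cover h x = c.cover h y ↔ (c.shift m ^ (n : ℤ)).SameCycle x y := by
  obtain ⟨⟨a, i⟩, rfl⟩ := (c.square m).surjective x
  obtain ⟨⟨b, j⟩, rfl⟩ := (c.square m).surjective y
  simp only [Equiv.Perm.SameCycle, ← zpow_mul, shift_zpow_square, cover_square,
    Equiv.apply_eq_iff_eq, Prod.mk.injEq, exists_and_right, and_congr_left_iff]
  rintro rfl
  obtain ⟨d, hd⟩ := ZMod.intCast_surjective (b - a)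
  obtain rfl : b = a + d := by rw [hd, add_sub_cancel]
  rw [map_add, map_intCast, left_eq_add, ZMod.intCast_zmod_eq_zero_iff_dvd]
  constructor
  · rintro ⟨t, rfl⟩
    exact ⟨t, rfl⟩
  · rintro ⟨t, ht⟩
    rw [add_right_inj] at ht
    have hdvd : (m : ℤ) ∣ d - n * t := (ZMod.intCast_eq_intCast_iff_dvd_sub _ _ _).1 ht
    exact (dvd_sub_left (dvd_mul_right _ t)).1 ((Int.natCast_dvd_natCast.2 h).trans hdvd)

end cover

variable {c} {j₀ : J} {r : ℕ}

/-- The horizontal row through `j₀` consists of three squares in every copy and ends in the next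
copy. Vertically, `j₀` is followed by a tower of `r` squares, which leads back to `j₀`, and this is
the only vertical chain of `r` squares that are horizontally glued to themselves. -/
structure HasUniqueTower (c : CyclicCopies O J) (j₀ : J) (r : ℕ) : Prop where
  right_pow_three : c.right ^ 3 = 1
  right_ne : c.right j₀ ≠ j₀
  carry_add_carry_add_carry : c.carry j₀ + c.carry (c.right j₀) + c.carry (c.right (c.right j₀)) = 1
  up_iterate : c.up^[r + 1] j₀ = j₀
  carry_eq_zero : ∀ j, c.right j = j → c.carry j = 0
  forall_right_iterate_up_iff : ∀ j, (∀ i < r, c.right (c.up^[i] j) = c.up^[i] j) ↔ j = c.up j₀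

namespace HasUniqueTower

variable (hc : c.HasUniqueTower j₀ r) {n m : ℕ+} {s : ℤ}

include hc

theorem right_square_eq_iff (a : ZMod n) (j : J) :
    (O n).right (c.square n (a, j)) = c.square n (a, j) ↔ c.right j = j := by
  rw [c.right_square, Equiv.apply_eq_iff_eq, Prod.mk.injEq, and_iff_right_iff_imp]
  intro hj
  rw [hc.carry_eq_zero j hj, Int.cast_zero, add_zero]

theorem forall_right_iterate_up_square_iff (a : ZMod n) (j : J) :
    (∀ i < r, (O n).right ((O n).up^[i] (c.square n (a, j))) =
      (O n).up^[i] (c.square n (a, j))) ↔ j = c.up j₀ := by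
  simp only [c.iterate_up_square, hc.right_square_eq_iff, hc.forall_right_iterate_up_iff]

theorem exists_apply_square_of_isShear {g : Equiv.Perm (O n).Square} (hg : IsShear 0 s g) :
    ∃ a, g (c.square n (0, j₀)) = c.square n (a, j₀) ∧
      ((O n).right ^ s) (c.square n (a, j₀)) = c.square n (a, j₀) := by
  obtain ⟨⟨a, j⟩, hgx⟩ := (c.square n).surjective (g (c.square n (0, c.up j₀)))
  have htower := (hc.forall_right_iterate_up_square_iff (0 : ZMod n) _).2 rfl
  have hiter := hg.apply_iterate_up htower
  obtain rfl : j = c.up j₀ := by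
    refine (hc.forall_right_iterate_up_square_iff a j).1 fun i hi => ?_
    rw [hgx, ← hiter i hi.le]
    exact (hg.1 _).symm.trans (congrArg g (htower i hi))
  have hbase : g (c.square n (0, j₀)) = c.square n (a, j₀) := by
    have := hiter r le_rfl
    rwa [← hgx, c.iterate_up_square, c.iterate_up_square, ← Function.iterate_succ_apply,
      hc.up_iterate] at this
  refine ⟨a, hbase, (O n).up.injective ?_⟩
  calc (O n).up (((O n).right ^ s) (c.square n (a, j₀)))
      = g ((O n).up (c.square n (0, j₀))) :=
        (congrArg (fun y => (O n).up (((O n).right ^ s) y)) hbase.symm).trans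
          (hg.2 (c.square n (0, j₀))).symm
    _ = (O n).up (c.square n (a, j₀)) := by rw [c.up_square, c.up_square, hgx]

theorem three_dvd_of_zpow_right (h : (c.right ^ s) j₀ = j₀) : 3 ∣ s := by
  have hperiod : Function.minimalPeriod c.right j₀ = 3 := by
    have : Fact (Nat.Prime 3) := ⟨Nat.prime_three⟩
    refine Function.minimalPeriod_eq_prime_iff.2 ⟨?_, hc.right_ne⟩
    rw [Function.IsPeriodicPt, Equiv.Perm.iterate_eq_pow, hc.right_pow_three]
    rfl
  have hdvd := MulAction.zpow_smul_eq_iff_minimalPeriod_dvd.1 (show c.right ^ s • j₀ = j₀ from h)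
  change ((Function.minimalPeriod c.right j₀ : ℕ) : ℤ) ∣ s at hdvd
  rwa [hperiod] at hdvd

theorem right_zpow_three_mul_square (z : ℤ) (a : ZMod n) (j : J) :
    ((O n).right ^ (3 * z)) (c.square n (a, j)) = c.square n
      (a + z * (c.carry j + c.carry (c.right j) + c.carry (c.right (c.right j)) : ℤ), j) := by
  have hright : c.right (c.right (c.right j)) = j := DFunLike.congr_fun hc.right_pow_three j
  rw [zpow_mul]
  refine c.zpow_square (fun a => ?_) z a
  change (O n).right ((O n).right ((O n).right _)) = _
  simp only [c.right_square, hright, Int.cast_add, add_assoc]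

theorem right_zpow_square_eq_iff (a : ZMod n) :
    ((O n).right ^ s) (c.square n (a, j₀)) = c.square n (a, j₀) ↔ 3 * (n : ℤ) ∣ s := by
  have hiff (q : ℤ) : ((O n).right ^ (3 * q)) (c.square n (a, j₀)) = c.square n (a, j₀) ↔
      3 * (n : ℤ) ∣ 3 * q := by
    rw [hc.right_zpow_three_mul_square, hc.carry_add_carry_add_carry, Int.cast_one, mul_one,
      mul_dvd_mul_iff_left three_ne_zero, ← ZMod.intCast_zmod_eq_zero_iff_dvd]
    simp
  suffices h3 : ((O n).right ^ s) (c.square n (a, j₀)) = c.square n (a, j₀) → 3 ∣ s by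
    constructor
    · intro h
      obtain ⟨q, rfl⟩ := h3 h
      exact (hiff q).1 h
    · intro h
      obtain ⟨q, rfl⟩ := (dvd_mul_right _ _).trans h
      exact (hiff q).2 h
  intro h
  apply hc.three_dvd_of_zpow_right
  rw [← c.zpow_right_square n s a j₀, h, Equiv.symm_apply_apply]

theorem right_zpow_three_mul_natCast : (O n).right ^ (3 * (n : ℤ)) = 1 := by
  refine Equiv.ext ((c.square n).surjective.forall.2 fun ⟨a, j⟩ => ?_)
  rw [hc.right_zpow_three_mul_square, Int.cast_natCast, ZMod.natCast_self, zero_mul, add_zero,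
    Equiv.Perm.one_apply]

theorem shearMatrix_mem_integralVeechGroup_iff :
    shearMatrix 0 s ∈ (O n).integralVeechGroup ↔ 3 * (n : ℤ) ∣ s := by
  rw [Origami.shearMatrix_mem_integralVeechGroup_iff]
  constructor
  · rintro ⟨g, hg⟩
    obtain ⟨a, -, ha⟩ := hc.exists_apply_square_of_isShear hg
    exact (hc.right_zpow_square_eq_iff a).1 ha
  · rintro ⟨q, rfl⟩
    refine ⟨1, .id_left, fun i => congrArg (O n).up ?_⟩
    change i = ((O n).right ^ (3 * (n : ℤ) * q)) i
    rw [zpow_mul, hc.right_zpow_three_mul_natCast, one_zpow, Equiv.Perm.one_apply]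

theorem translations_eq_zpowers_shift : (O n).translations = Subgroup.zpowers (c.shift n) := by
  refine le_antisymm (fun g hg => ?_) (Subgroup.zpowers_le.2 (c.shift_mem_translations n))
  have hshear : IsShear 0 0 g :=
    ⟨mem_translations.1 hg 0, fun i => (mem_translations.1 hg 1 i).trans rfl⟩
  obtain ⟨a, ha, -⟩ := hc.exists_apply_square_of_isShear hshear
  obtain ⟨z, rfl⟩ := ZMod.intCast_surjective a
  refine ⟨z, (eq_of_mem_translations hg ?_ (i := c.square n (0, j₀)) ?_).symm⟩
  · exact Subgroup.zpow_mem _ (c.shift_mem_translations n) z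
  · rw [ha, c.shift_zpow_square, zero_add]

theorem veechGroup_le_veechGroup_iff : (O m).veechGroup ≤ (O n).veechGroup ↔ n ∣ m := by
  rw [Origami.veechGroup_le_veechGroup_iff, PNat.dvd_iff]
  constructor
  · intro hle
    have hmem := hle (hc.shearMatrix_mem_integralVeechGroup_iff.2 (dvd_refl (3 * (m : ℤ))))
    rw [hc.shearMatrix_mem_integralVeechGroup_iff, mul_dvd_mul_iff_left three_ne_zero] at hmem
    exact Int.natCast_dvd_natCast.1 hmem
  · intro h
    exact integralVeechGroup_le_of_cover (c.surjective_cover h) (c.semiconj_cover h)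
      hc.translations_eq_zpowers_shift (c.cover_eq_cover_iff h)

theorem mapGL_T_zpow_mem_veechGroup_iff :
    Matrix.SpecialLinearGroup.mapGL ℝ (ModularGroup.T ^ s) ∈ (O n).veechGroup ↔
      3 * (n : ℤ) ∣ s := by
  rw [mapGL_mem_veechGroup, T_zpow_eq_shearMatrix, hc.shearMatrix_mem_integralVeechGroup_iff]

theorem isNoncongruenceGroup_veechGroup (hup : (O n).up ^ (12 : ℤ) = 1)
    (hright : ((O n).right * (O n).up ^ (-3 : ℤ)) ^ (4 : ℤ) = 1) :
    IsNoncongruenceGroup (O n).veechGroup :=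
  Origami.isNoncongruenceGroup_veechGroup
    (fun _ hs => (dvd_mul_right 3 _).trans (hc.shearMatrix_mem_integralVeechGroup_iff.1 hs))
    hup hright

end HasUniqueTower

end CyclicCopies

/-- The sequence `seqL`, where only the right edge of the square `3` leads to the next copy. -/
def cyclicCopiesL : CyclicCopies seqL (Fin 4) where
  square _ := Equiv.refl _
  right := ⟨![2, 1, 3, 0], ![3, 1, 0, 2], by decide, by decide⟩
  up := Equiv.swap 0 1
  carry := ![0, 0, 0, 1]
  right_square n a j := by
    change rightL n (a, j) = (_, _)
    fin_cases j <;> simp [rightL]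
  up_square _ _ _ := rfl

theorem hasUniqueTower_cyclicCopiesL : cyclicCopiesL.HasUniqueTower 0 1 where
  right_pow_three := by decide
  right_ne := by decide
  carry_add_carry_add_carry := by decide
  up_iterate := by decide
  carry_eq_zero := by decide
  forall_right_iterate_up_iff := by decide

theorem isNoncongruenceGroup_veechGroup_seqL_one : IsNoncongruenceGroup (seqL 1).veechGroup :=
  hasUniqueTower_cyclicCopiesL.isNoncongruenceGroup_veechGroup
    (show upL 1 ^ (12 : ℤ) = 1 by decide)
    (show (rightL 1 * upL 1 ^ (-3 : ℤ)) ^ (4 : ℤ) = 1 by decide)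

/-- The sequence `seqD`, where only the right edge of the square `2` leads to the next copy. -/
def cyclicCopiesD : CyclicCopies seqD (Fin 5) where
  square _ := Equiv.refl _
  right := ⟨![1, 2, 0, 3, 4], ![2, 0, 1, 3, 4], by decide, by decide⟩
  up := ⟨![3, 2, 1, 4, 0], ![4, 2, 1, 0, 3], by decide, by decide⟩
  carry := ![0, 0, 1, 0, 0]
  right_square n a j := by
    change rightD n (a, j) = (_, _)
    fin_cases j <;> simp [rightD]
  up_square _ _ _ := rfl

theorem hasUniqueTower_cyclicCopiesD : cyclicCopiesD.HasUniqueTower 0 2 where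
  right_pow_three := by decide
  right_ne := by decide
  carry_add_carry_add_carry := by decide
  up_iterate := by decide
  carry_eq_zero := by decide
  forall_right_iterate_up_iff := by decide

theorem isNoncongruenceGroup_veechGroup_seqD_one : IsNoncongruenceGroup (seqD 1).veechGroup :=
  hasUniqueTower_cyclicCopiesD.isNoncongruenceGroup_veechGroup
    (show upD 1 ^ (12 : ℤ) = 1 by decide)
    (show (rightD 1 * upD 1 ^ (-3 : ℤ)) ^ (4 : ℤ) = 1 by decide)

end Origami

theorem mainTheorem3 (O : ℕ+ → Origami) (hO : O = Origami.seqL ∨ O = Origami.seqD) :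
    (∀ n, (O n).veechGroup ≤ (O 1).veechGroup) ∧
    IsNoncongruenceGroup (O 1).veechGroup ∧
    (∀ n m : ℕ+, n ∣ m → (O m).veechGroup ≤ (O n).veechGroup) ∧
    (∀ n m : ℕ+, n ≠ m → (O n).veechGroup ≠ (O m).veechGroup) ∧
    (∀ (n : ℕ+) (s : ℤ),
      Matrix.SpecialLinearGroup.mapGL ℝ (ModularGroup.T ^ s) ∈ (O n).veechGroup ↔
        3 * (n : ℤ) ∣ s) := by
  obtain ⟨J, c, j₀, r, hc⟩ :
      ∃ (J : Type) (c : Origami.CyclicCopies O J) (j₀ : J) (r : ℕ), c.HasUniqueTower j₀ r := by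
    rcases hO with rfl | rfl
    · exact ⟨_, _, _, _, Origami.hasUniqueTower_cyclicCopiesL⟩
    · exact ⟨_, _, _, _, Origami.hasUniqueTower_cyclicCopiesD⟩
  have hle (n m) : (O m).veechGroup ≤ (O n).veechGroup ↔ n ∣ m := hc.veechGroup_le_veechGroup_iff
  refine ⟨fun n => (hle 1 n).2 (one_dvd n), ?_, fun n m => (hle n m).2, fun n m hnm h => hnm ?_,
    fun n s => hc.mapGL_T_zpow_mem_veechGroup_iff⟩
  · rcases hO with rfl | rfl
    · exact Origami.isNoncongruenceGroup_veechGroup_seqL_one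
    · exact Origami.isNoncongruenceGroup_veechGroup_seqD_one
  · exact PNat.dvd_antisymm ((hle n m).1 h.ge) ((hle m n).1 h.le)
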